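/- All graphs are finite and simple. A *$\Delta$-completion set* of a graph $G$ is a set $F$ of non-edges of $G$ (pairs of distinct non-adjacent vertices) such that every vertex of the graph $G+F$ lies in a triangle of $G+F$; let $\Delta_G$ be the minimum size of a $\Delta$-completion set of $G$. A vertex is *unsaturated* if it lies in no triangle of $G$; let $U$ be the set of unsaturated vertices. For vertices $u,v$ with $\mathrm{dist}_G(u,v)=2$ let $$S_{uv}=\{w\in U: uw\in E(G),\ vw\in E(G)\}\cup(\{u,v\}\cap U).$$ **Theorem.** There is a deterministic algorithm that maps each graph $G$ on a vertex set $\{0,\dots,n-1\}$ (given by its adjacency matrix) to a set $A(G)$ of pairs of vertices of $G$, that runs in polynomial time (on a multi-stack Turing machine, in the length of the encoded input), and that has the following properties for each graph $G$ of order $n$ all of whose components have at least three vertices. 1. $A(G)$ is a $\Delta$-completion set of $G$ and $|A(G)|\le(\ln n+1)\,\Delta_G$. (For $n=0$ we have $A(G)=\emptyset$ and $\Delta_G=0$.) 2. $A(G)$ is the set of pairs chosen by a complete run of greedy Set Cover on the ground set $U$ with the sets $S_{uv}$, $\mathrm{dist}_G(u,v)=2$: while some vertex of $U$ is uncovered,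 a pair $uv$ at distance two is chosen for which $S_{uv}$ contains the largest possible number of uncovered vertices. Moreover, for each such $G$, restricting to pairs at distance two loses nothing: $G$ has a $\Delta$-completion set $F$ with $|F|=\Delta_G$ such that $\mathrm{dist}_G(u,v)=2$ for all $uv\in F$. -/

import Mathlib

namespace DeltaCompletion

section Graphs

variable {V : Type*}

/-- The vertex `v` lies in a triangle of `G`. -/
def InTriangle (G : SimpleGraph V) (v : V) : Prop :=
  ∃ u w, G.Adj v u ∧ G.Adj v w ∧ G.Adj u w

/-- Every vertex of `G` belongs to at least one triangle. -/
def IsTriangleCovered (G : SimpleGraph V) : Prop :=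
  ∀ v, InTriangle G v

/-- `F` is a set of non-edges of `G` whose addition to `G` gives a triangle-covered graph. -/
def IsCompletionSet (G : SimpleGraph V) (F : Finset (Sym2 V)) : Prop :=
  (∀ e ∈ F, ¬ e.IsDiag ∧ e ∉ G.edgeSet) ∧
    IsTriangleCovered (G ⊔ SimpleGraph.fromEdgeSet (F : Set (Sym2 V)))

/-- The minimum size of a completion set of `G` (for the graphs of the theorem, completion
sets exist, so this is an attained minimum). -/
noncomputable def completionNumber (G : SimpleGraph V) : ℕ :=
  sInf {k | ∃ F : Finset (Sym2 V), IsCompletionSet G F ∧ F.card = k}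

/-- The unsaturated vertices: those in no triangle of `G`. -/
def unsaturated (G : SimpleGraph V) : Set V :=
  {v | ¬ InTriangle G v}

/-- The set `S_{uv}`: unsaturated common neighbours of `u` and `v`, and `u`, `v` themselves
if they are unsaturated. -/
def coverSet (G : SimpleGraph V) (u v : V) : Set V :=
  {w | w ∈ unsaturated G ∧ G.Adj u w ∧ G.Adj v w} ∪ ({u, v} ∩ unsaturated G)

/-- `GreedyRun G R L`: starting with the set `R` of vertices still to be covered, `L` is the
list of choices of a complete run of greedy Set Cover for the family of all `S_{uv}` with
`u`, `v` at distance two.  As long as something is uncovered, a pair `(u, v)` is chosen whose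
set covers the largest number of uncovered vertices; the run ends when all are covered. -/
inductive GreedyRun (G : SimpleGraph V) : Set V → List (V × V) → Prop
  | done : GreedyRun G ∅ []
  | step {R : Set V} {u v : V} {L : List (V × V)}
      (hdist : G.dist u v = 2)
      (hpos : (R ∩ coverSet G u v).Nonempty)
      (hmax : ∀ x y, G.dist x y = 2 →
        (R ∩ coverSet G x y).ncard ≤ (R ∩ coverSet G u v).ncard)
      (hrest : GreedyRun G (R \ coverSet G u v) L) :
      GreedyRun G R ((u, v) :: L)

end Graphs

section Encoding

open Classical in
/-- The matrix of a relation on `Fin n`, written row by row as a string over the three-letter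
alphabet `Option Bool`: the entries are `some true` and `some false`, and `none` ends a row. -/
noncomputable def encodeRel (n : ℕ) (r : Fin n → Fin n → Prop) : List (Option Bool) :=
  (List.finRange n).flatMap fun i =>
    (List.finRange n).map (fun j => some (decide (r i j))) ++ [none]

/-- A finite graph given by its order `n` and its adjacency on the vertex set `Fin n`. -/
abbrev FinGraph : Type := Σ n : ℕ, SimpleGraph (Fin n)

/-- A set of unordered pairs of elements of `Fin n`, together with `n`. -/
abbrev FinPairSet : Type := Σ n : ℕ, Finset (Sym2 (Fin n))

/-- Graphs are encoded by their adjacency matrix. -/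
noncomputable def encodeGraph (G : FinGraph) : List (Option Bool) :=
  encodeRel G.1 G.2.Adj

/-- Sets of pairs are encoded by their (symmetric) incidence matrix. -/
noncomputable def encodePairSet (F : FinPairSet) : List (Option Bool) :=
  encodeRel F.1 fun i j => s(i, j) ∈ F.2

/-- The map `A`, from graphs to sets of pairs of their vertices, is computed by a multi-stack
Turing machine within a number of steps polynomial in the length of the encoded graph. -/
def IsPolyTime (A : ∀ n : ℕ, SimpleGraph (Fin n) → Finset (Sym2 (Fin n))) : Prop :=
  Nonempty (Turing.TM2ComputableInPolyTime encodeGraph encodePairSet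
    fun G : FinGraph => (⟨G.1, A G.1 G.2⟩ : FinPairSet))

end Encoding

end DeltaCompletion

/-! Adding a pair `uv` at distance two puts `u`, `v` and all their common neighbours into triangles.
Hence a family of such pairs whose sets cover the unsaturated vertices is a completion set
(`IsDistTwoCover.isCompletionSet`).

Conversely, a completion set `F` can be turned into such a cover without growing
(`IsCompletionSet.exists_isDistTwoCover`). Let `H` consist of the pairs of `F` not at distance two,
and let `W` be the unsaturated vertices that the other pairs of `F` leave uncovered. In each
component of `H`, orienting a breadth-first tree assigns distinct `H`-edges to all vertices except
the root, and a root in a triangle of `H` also gets an edge of its own (`exists_injOn_edgeSet`). The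
root can be chosen so that it lies outside `W`, or in a triangle of `H`, or can share one
distance-two pair with another vertex of `W` in its component. So the `H`-edges can be replaced by
at most as many distance-two pairs covering `W`. The minimum completion number is therefore the
optimum of the Set Cover instance, and the usual harmonic bound for greedy applies
(`GreedyRun.length_le`), with `harmonic r ≤ 1 + log r`.

For the running time, greedy is organised by decreasing thresholds `t`: every pair in turn is chosen
if it covers more than `t` uncovered vertices. Before the sweep no pair covers more than `t + 1`, so
each choice is a maximum, and after the sweep no pair covers more than `t` (`greedyState_main`). The
algorithm thus uses only bounded loops, matrix lookups and comparisons with counters. It is written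
in a small language of stack programs that compiles to multi-stack machines (`Exec.simulates`), and
polynomial bounds are carried through its constructors (`IsExpr`, `IsGuard`, `IsCmd`). -/

namespace DeltaCompletion

/-! ### Stack programs and their compilation to machines -/

/-- Structured programs on stacks indexed by `K` over the alphabet `α`. -/
inductive Prog (K α : Type) : Type
  | skip : Prog K α
  | push (k : K) (a : α) : Prog K α
  | seq (p q : Prog K α) : Prog K α
  | popCase (k : K) (p : Option α → Prog K α) : Prog K α
  | popWhile (k : K) (p : α → Prog K α) : Prog K α

namespace Prog

variable {K α : Type}

/-- Big-step semantics: `Exec p S T t` says that `p` takes the stacks `S` to `T` in `t` steps. -/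
inductive Exec [DecidableEq K] : Prog K α → (K → List α) → (K → List α) → ℕ → Prop
  | skip (S : K → List α) : Exec skip S S 1
  | push (S : K → List α) (k : K) (a : α) :
      Exec (push k a) S (Function.update S k (a :: S k)) 1
  | seq {p q : Prog K α} {S S₁ S₂ : K → List α} {t₁ t₂ : ℕ} :
      Exec p S S₁ t₁ → Exec q S₁ S₂ t₂ → Exec (seq p q) S S₂ (t₁ + t₂)
  | popCase {k : K} {p : Option α → Prog K α} {S S₁ : K → List α} {t : ℕ} :
      Exec (p (S k).head?) (Function.update S k (S k).tail) S₁ t →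
      Exec (popCase k p) S S₁ (t + 1)
  | whileNil {k : K} {p : α → Prog K α} {S : K → List α} : S k = [] →
      Exec (popWhile k p) S S 1
  | whileCons {k : K} {p : α → Prog K α} {S S₁ S₂ : K → List α} {a : α} {l : List α}
      {t₁ t₂ : ℕ} : S k = a :: l → Exec (p a) (Function.update S k l) S₁ t₁ →
      Exec (popWhile k p) S₁ S₂ t₂ → Exec (popWhile k p) S S₂ (t₁ + t₂ + 1)

/-- The labels of the machine code of a program. -/
def Label : Prog K α → Type
  | skip => Unit
  | push _ _ => Unit
  | seq p q => Label p ⊕ Label q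
  | popCase _ p => Option (Σ o, Label (p o))
  | popWhile _ p => Option (Σ a, Label (p a))

/-- A program has finitely many labels. -/
@[reducible]
noncomputable def fintypeLabel [Fintype α] : (p : Prog K α) → Fintype (Label p)
  | skip => inferInstanceAs (Fintype Unit)
  | push _ _ => inferInstanceAs (Fintype Unit)
  | seq p q =>
    letI := fintypeLabel p
    letI := fintypeLabel q
    inferInstanceAs (Fintype (Label p ⊕ Label q))
  | popCase _ p =>
    letI := fun o => fintypeLabel (p o)
    inferInstanceAs (Fintype (Option (Σ o, Label (p o))))
  | popWhile _ p =>
    letI := fun a => fintypeLabel (p a)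
    inferInstanceAs (Fintype (Option (Σ a, Label (p a))))

/-- The label at which the code of a program is entered. -/
def entry : (p : Prog K α) → Label p
  | skip => ()
  | push _ _ => ()
  | seq p _ => Sum.inl (entry p)
  | popCase _ _ => none
  | popWhile _ _ => none

open Turing.TM2 in
/-- The machine code of a program, its labels embedded into `Λ` by `emb`; it continues with
the label `exit`. The internal state holds the symbol popped last. -/
def code {Λ : Type} : (p : Prog K α) → (Label p → Λ) → Λ → Label p →
    Stmt (fun _ : K => α) Λ (Option α)
  | skip, _, exit, _ => Stmt.goto fun _ => exit
  | push k a, _, exit, _ => Stmt.push k (fun _ => a) (Stmt.goto fun _ => exit)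
  | seq p q, emb, exit, l =>
    match l with
    | Sum.inl l => code p (fun l => emb (Sum.inl l)) (emb (Sum.inr (entry q))) l
    | Sum.inr l => code q (fun l => emb (Sum.inr l)) exit l
  | popCase k p, emb, exit, l =>
    match l with
    | none => Stmt.pop k (fun _ o => o) (Stmt.goto fun o => emb (some ⟨o, entry (p o)⟩))
    | some ⟨o, l⟩ => code (p o) (fun l => emb (some ⟨o, l⟩)) exit l
  | popWhile k p, emb, exit, l =>
    match l with
    | none => Stmt.pop k (fun _ o => o) (Stmt.goto fun o =>
        match o with
        | none => exit
        | some a => emb (some ⟨a, entry (p a)⟩))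
    | some ⟨a, l⟩ => code (p a) (fun l => emb (some ⟨a, l⟩)) (emb none) l

variable [DecidableEq K]

theorem iterate_step_trans {Λ : Type} {m : Λ → Turing.TM2.Stmt (fun _ : K => α) Λ (Option α)}
    {a b c : Option (Turing.TM2.Cfg (fun _ : K => α) Λ (Option α))} {s t : ℕ}
    (h₁ : (flip bind (Turing.TM2.step m))^[s] a = b)
    (h₂ : (flip bind (Turing.TM2.step m))^[t] b = c) :
    (flip bind (Turing.TM2.step m))^[s + t] a = c := by
  rw [add_comm, Function.iterate_add_apply, h₁, h₂]

/-- The label type, the embedding and the exit are arbitrary so that the induction reaches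
subprograms inside a larger code. The initial internal state does not matter: code branches on it
only directly after a pop has overwritten it. -/
theorem Exec.simulates {p : Prog K α} {S T : K → List α} {t : ℕ} (h : Exec p S T t) :
    ∀ {Λ : Type} (m : Λ → Turing.TM2.Stmt (fun _ : K => α) Λ (Option α))
      (emb : Label p → Λ) (exit : Λ), (∀ l, m (emb l) = code p emb exit l) → ∀ v,
      ∃ w, (flip bind (Turing.TM2.step m))^[t] (some ⟨some (emb (entry p)), v, S⟩) =
        some ⟨some exit, w, T⟩ := by
  induction h with
  | skip S =>
    intro Λ m emb exit hm v
    exact ⟨v, by simp [flip, hm, code]⟩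
  | push S k a =>
    intro Λ m emb exit hm v
    exact ⟨v, by simp [flip, hm, code]⟩
  | @seq p q S S₁ S₂ t₁ t₂ _ _ ih₁ ih₂ =>
    intro Λ m emb exit hm v
    obtain ⟨w₁, h₁⟩ := ih₁ m (fun l => emb (Sum.inl l)) (emb (Sum.inr (entry q)))
      (fun l => hm (Sum.inl l)) v
    obtain ⟨w₂, h₂⟩ := ih₂ m (fun l => emb (Sum.inr l)) exit (fun l => hm (Sum.inr l)) w₁
    exact ⟨w₂, iterate_step_trans h₁ h₂⟩
  | @popCase k p S S₁ t _ ih =>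
    intro Λ m emb exit hm v
    obtain ⟨w, h⟩ := ih m (fun l => emb (some ⟨_, l⟩)) exit (fun l => hm (some ⟨_, l⟩))
      (S k).head?
    refine ⟨w, ?_⟩
    have h₀ := hm none
    simp only [code] at h₀
    rw [Function.iterate_succ_apply, ← h]
    simp [flip, h₀, entry]
  | @whileNil k p S hS =>
    intro Λ m emb exit hm v
    refine ⟨none, ?_⟩
    have : Function.update S k [] = S := by rw [← hS, Function.update_eq_self]
    have h₀ := hm none
    simp only [code] at h₀
    simp [flip, h₀, entry, hS, this]
  | @whileCons k p S S₁ S₂ a l t₁ t₂ hS _ _ ih₁ ih₂ =>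
    intro Λ m emb exit hm v
    obtain ⟨w₁, h₁⟩ := ih₁ m (fun l => emb (some ⟨a, l⟩)) (emb none)
      (fun l => hm (some ⟨a, l⟩)) (some a)
    obtain ⟨w₂, h₂⟩ := ih₂ m emb exit hm w₁
    refine ⟨w₂, ?_⟩
    rw [Function.iterate_succ_apply, ← iterate_step_trans h₁ h₂]
    have h₀ := hm none
    simp only [code] at h₀
    simp [flip, h₀, entry, hS]

/-- The machine running a program, which then resets its internal state and halts. -/
noncomputable def machine [Fintype K] [Fintype α] (p : Prog K α) (k₀ k₁ : K) :
    Turing.FinTM2 where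
  K := K
  k₀ := k₀
  k₁ := k₁
  Γ := fun _ => α
  Λ := Option (Label p)
  main := some (entry p)
  ΛFin := letI := fintypeLabel p; inferInstanceAs (Fintype (Option (Label p)))
  σ := Option α
  initialState := none
  Γk₀Fin := inferInstance
  m := fun l => match l with
    | none => Turing.TM2.Stmt.load (fun _ => none) Turing.TM2.Stmt.halt
    | some l => code p some none l

/-- A program that turns the input `l` into the output `l'` in `t` steps gives a machine that
does so in `t + 1` steps. -/
theorem Exec.outputs [Fintype K] [Fintype α] {p : Prog K α} {k₀ k₁ : K} {l l' : List α}
    {t T : ℕ} (h : Exec p (Function.update (fun _ => []) k₀ l)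
      (Function.update (fun _ => []) k₁ l') t) (ht : t + 1 ≤ T) :
    Nonempty (Turing.TM2OutputsInTime (machine p k₀ k₁) l (some l') T) := by
  obtain ⟨w, hw⟩ := h.simulates (machine p k₀ k₁).m some none (fun _ => rfl) none
  refine ⟨⟨⟨t + 1, ?_⟩, ht⟩⟩
  have e₁ : Turing.initList (machine p k₀ k₁) l =
      ⟨some (some (entry p)), none, Function.update (fun _ => []) k₀ l⟩ := by
    unfold Turing.initList
    congr 1
    funext (k : K)
    change @dite _ (k = k₀) (‹DecidableEq K› k k₀) _ _ = Function.update (fun _ : K => []) k₀ l k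
    by_cases hk : k = k₀
    · subst hk
      rw [Function.update_self]
      exact dif_pos rfl
    · rw [Function.update_of_ne hk]
      exact dif_neg hk
  have e₂ : Turing.haltList (machine p k₀ k₁) l' =
      ⟨none, none, Function.update (fun _ => []) k₁ l'⟩ := by
    unfold Turing.haltList
    congr 1
    funext (k : K)
    change @dite _ (k = k₁) (‹DecidableEq K› k k₁) _ _ = Function.update (fun _ : K => []) k₁ l' k
    by_cases hk : k = k₁
    · subst hk
      rw [Function.update_self]
      exact dif_pos rfl
    · rw [Function.update_of_ne hk]
      exact dif_neg hk
  rw [e₁]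
  change _ = some (Turing.haltList (machine p k₀ k₁) l')
  rw [e₂]
  -- The one extra step resets the internal state, as `haltList` demands, and halts.
  refine iterate_step_trans hw ?_
  rfl

/-! ### Time-bounded execution and loops over a stack -/

/-- `Runs p S T t` says that `p` takes the stacks `S` to `T` in at most `t` steps. -/
def Runs (p : Prog K α) (S T : K → List α) (t : ℕ) : Prop :=
  ∃ s ≤ t, Exec p S T s

theorem Runs.mono {p : Prog K α} {S T : K → List α} {t t' : ℕ} (h : Runs p S T t)
    (ht : t ≤ t') : Runs p S T t' :=
  let ⟨s, hs, e⟩ := h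
  ⟨s, hs.trans ht, e⟩

theorem runs_skip (S : K → List α) : Runs skip S S 1 := ⟨1, le_rfl, Exec.skip S⟩

theorem runs_push (S : K → List α) (k : K) (a : α) :
    Runs (push k a) S (Function.update S k (a :: S k)) 1 := ⟨1, le_rfl, Exec.push S k a⟩

theorem Runs.seq {p q : Prog K α} {S S₁ S₂ : K → List α} {t₁ t₂ : ℕ}
    (h₁ : Runs p S S₁ t₁) (h₂ : Runs q S₁ S₂ t₂) : Runs (p.seq q) S S₂ (t₁ + t₂) :=
  let ⟨_, l₁, e₁⟩ := h₁
  let ⟨_, l₂, e₂⟩ := h₂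
  ⟨_, add_le_add l₁ l₂, e₁.seq e₂⟩

theorem Runs.popCase {k : K} {p : Option α → Prog K α} {S S₁ : K → List α} {t : ℕ}
    (h : Runs (p (S k).head?) (Function.update S k (S k).tail) S₁ t) :
    Runs (popCase k p) S S₁ (t + 1) :=
  let ⟨_, l, e⟩ := h
  ⟨_, Nat.succ_le_succ l, e.popCase⟩

theorem runs_popWhile_nil {k : K} {p : α → Prog K α} {S : K → List α} (h : S k = []) :
    Runs (popWhile k p) S S 1 := ⟨1, le_rfl, Exec.whileNil h⟩

theorem Runs.popWhile_cons {k : K} {p : α → Prog K α} {S S₁ S₂ : K → List α} {a : α}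
    {l : List α} {t₁ t₂ : ℕ} (h : S k = a :: l)
    (h₁ : Runs (p a) (Function.update S k l) S₁ t₁) (h₂ : Runs (popWhile k p) S₁ S₂ t₂) :
    Runs (popWhile k p) S S₂ (t₁ + t₂ + 1) :=
  let ⟨_, l₁, e₁⟩ := h₁
  let ⟨_, l₂, e₂⟩ := h₂
  ⟨_, Nat.succ_le_succ (add_le_add l₁ l₂), e₁.whileCons h e₂⟩

theorem Runs.congr {p : Prog K α} {S S' T T' : K → List α} {t t' : ℕ} (h : Runs p S T t)
    (hS : S' = S) (hT : T = T') (ht : t ≤ t') : Runs p S' T' t' := by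
  subst hS hT
  exact h.mono ht

/-- Move the contents of the stack `k` to the stack `k'`, in reverse order. -/
def move (k k' : K) : Prog K α := popWhile k fun a => push k' a

theorem runs_move {k k' : K} (hk : k ≠ k') (S : K → List α) :
    Runs (move k k') S (Function.update (Function.update S k' ((S k).reverse ++ S k')) k [])
      (2 * (S k).length + 1) := by
  generalize hL : S k = L
  induction L generalizing S with
  | nil =>
    refine (runs_popWhile_nil hL).congr rfl ?_ (by simp)
    rw [List.reverse_nil, List.nil_append, Function.update_eq_self, ← hL,
      Function.update_eq_self]
  | cons a l ih =>
    refine (Runs.popWhile_cons (S := S) hL (runs_push _ _ _)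
      (ih _ (by simp [Function.update_of_ne hk]))).congr rfl ?_ (by simp; lia)
    funext j
    by_cases h₁ : j = k
    · simp [h₁]
    · by_cases h₂ : j = k'
      · simp [h₂, hk.symm]
      · simp [h₁, h₂]

/-- Run `p` once for each symbol of the stack `k`, which is preserved; the stack `h` holds the
symbols already visited. -/
def forEach (k h : K) (p : Prog K α) : Prog K α :=
  (popWhile k fun a => (push h a).seq p).seq (move h k)

/-- `G i` describes the stacks after `i` rounds. The body must work for any contents of `k` and `h`,
since these hold the unvisited and the visited symbols during the loop; nested loops therefore need
different stacks `h`. -/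
theorem runs_forEach {k h : K} (hk : h ≠ k) {p : Prog K α} {t : ℕ} (G : ℕ → K → List α)
    (L : List α) (hGk : ∀ i, G i k = L) (hGh : ∀ i, G i h = [])
    (hp : ∀ i < L.length, ∀ l l', Runs p (Function.update (Function.update (G i) k l) h l')
      (Function.update (Function.update (G (i + 1)) k l) h l') t) :
    Runs (forEach k h p) (G 0) (G L.length) (L.length * (t + 4) + 2) := by
  have key : ∀ l pre : List α, pre ++ l = L →
      Runs (popWhile k fun a => (push h a).seq p)
        (Function.update (Function.update (G pre.length) k l) h pre.reverse)
        (Function.update (Function.update (G L.length) k []) h L.reverse)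
        (l.length * (t + 2) + 1) := by
    intro l
    induction l with
    | nil =>
      intro pre hpre
      rw [List.append_nil] at hpre
      subst hpre
      exact (runs_popWhile_nil (by simp [hk.symm])).mono (by simp)
    | cons a l ih =>
      intro pre hpre
      have h₂ := ih (pre ++ [a]) (by simpa using hpre)
      have h₁ := (hp pre.length (by simp [← hpre]) l (a :: pre.reverse)).congr
        (S' := Function.update (Function.update (Function.update (Function.update
          (G pre.length) k (a :: l)) h pre.reverse) k l) h (a :: pre.reverse))
        (T' := Function.update (Function.update (G (pre ++ [a]).length) k l) h
          (pre ++ [a]).reverse) ?_ (by simp) le_rfl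
      · refine (Runs.popWhile_cons (a := a) (l := l) (by simp [hk.symm])
          (Runs.seq (runs_push _ _ _) (h₁.congr ?_ rfl le_rfl)) h₂).mono (by simp; lia)
        simp [hk]
      · funext j
        by_cases h₁ : j = k
        · simp [h₁, hk.symm]
        · by_cases h₂ : j = h
          · simp [h₂]
          · simp [h₁, h₂]
  refine ((key L [] rfl).seq (runs_move hk _)).congr ?_ ?_ (by simp; lia)
  all_goals
    funext j
    by_cases h₁ : j = k
    · simp [h₁, hk.symm, hGk]
    · by_cases h₂ : j = h
      · simp [h₂, hGh]
      · simp [h₁, h₂]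

end Prog

/-! ### Memory layout and access to matrix entries -/

/-- The stacks of the machine: input, output, a unary counter for the order `n`, three scratch
store, a stack for evaluating expressions, a counter, unary loop variables, and matrices. -/
inductive Stk : Type
  | inp | out | cnt | aux₁ | aux₂ | aux₃ | ev | ctr
  | var (i : Fin 5)
  | arr (i : Fin 4)
  deriving DecidableEq, Fintype

/-- The alphabet of the store. -/
abbrev Sym : Type := Option Bool

/-- The memory: Boolean matrices, stored row by row, and the output. -/
structure Mem where
  /-- the matrices -/
  arr : Fin 4 → ℕ → Bool
  /-- the output written so far -/
  out : List Sym

/-- The entries of a matrix of order `n`. -/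
def entries (n : ℕ) (a : ℕ → Bool) : List Sym := (List.range (n * n)).map fun i => some (a i)

/-- A number in unary. -/
def unary (n : ℕ) : List Sym := List.replicate n (some true)

/-- The contents of the stacks for given values of the variables and given memory. -/
def store (n : ℕ) (env : Fin 5 → ℕ) (M : Mem) (B C : List Sym) : Stk → List Sym
  | .inp => []
  | .out => M.out
  | .cnt => unary n
  | .aux₁ => []
  | .aux₂ => []
  | .aux₃ => []
  | .ev => B
  | .ctr => C
  | .var i => unary (env i)
  | .arr i => entries n (M.arr i)

/-- The variables below `d` are in use, as indices less than `n`. -/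
def Scoped (d n : ℕ) (env : Fin 5 → ℕ) : Prop :=
  ∀ i : Fin 5, (i.val < d → env i < n) ∧ (d ≤ i.val → env i = 0)

theorem Scoped.le {d n : ℕ} {env : Fin 5 → ℕ} (h : Scoped d n env) (i : Fin 5) : env i ≤ n := by
  rcases lt_or_ge i.val d with hi | hi
  · exact ((h i).1 hi).le
  · simp [(h i).2 hi]

theorem Scoped.update {d n : ℕ} {env : Fin 5 → ℕ} (h : Scoped d n env) {w : Fin 5}
    (hw : w.val = d) {i : ℕ} (hi : i < n) : Scoped (d + 1) n (Function.update env w i) := by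
  intro j
  by_cases hj : j = w
  · subst hj
    simp [hi]
    lia
  · rw [Function.update_of_ne hj]
    have : j.val ≠ d := fun e => hj (Fin.ext (e.trans hw.symm))
    exact ⟨fun h' => (h j).1 (by lia), fun h' => (h j).2 (by lia)⟩

@[simp] theorem unary_length (n : ℕ) : (unary n).length = n := by simp [unary]

theorem unary_succ (n : ℕ) : unary (n + 1) = some true :: unary n := rfl

@[simp] theorem unary_zero : unary 0 = [] := rfl

@[simp] theorem unary_reverse (n : ℕ) : (unary n).reverse = unary n := by simp [unary]

@[simp] theorem entries_length (n : ℕ) (a : ℕ → Bool) : (entries n a).length = n * n := by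
  simp [entries]

theorem update_ev (n : ℕ) (env : Fin 5 → ℕ) (M : Mem) (B C L : List Sym) :
    Function.update (store n env M B C) .ev L = store n env M L C := by
  funext k
  cases k <;> simp [store, Function.update]

theorem update_ctr (n : ℕ) (env : Fin 5 → ℕ) (M : Mem) (B C L : List Sym) :
    Function.update (store n env M B C) .ctr L = store n env M B L := by
  funext k
  cases k <;> simp [store, Function.update]

theorem update_out (n : ℕ) (env : Fin 5 → ℕ) (M : Mem) (B C L : List Sym) :
    Function.update (store n env M B C) .out L = store n env { M with out := L } B C := by
  funext k
  cases k <;> simp [store, Function.update]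

theorem update_var (n : ℕ) (env : Fin 5 → ℕ) (M : Mem) (B C : List Sym) (w : Fin 5) (i : ℕ) :
    Function.update (store n env M B C) (.var w) (unary i) =
      store n (Function.update env w i) M B C := by
  funext k
  cases k with
  | var j => by_cases h : j = w <;> simp [store, Function.update, h]
  | _ => simp [store, Function.update]

open Prog Polynomial

/-- Move one symbol from `k` to `k'`. -/
def shift (k k' : Stk) : Prog Stk Sym :=
  popCase k fun o => match o with
    | none => skip
    | some a => push k' a

/-- The stacks `S` with the first `p` symbols of the matrix `x` shifted to the scratch stack. -/
def split (x : Fin 4) (S : Stk → List Sym) (p : ℕ) : Stk → List Sym :=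
  Function.update (Function.update S (.arr x) ((S (.arr x)).drop p)) .aux₃
    ((S (.arr x)).take p).reverse

theorem split_update (x : Fin 4) (S : Stk → List Sym) (p : ℕ) {k : Stk} (L : List Sym)
    (h₁ : k ≠ .arr x) (h₂ : k ≠ .aux₃) :
    Function.update (split x S p) k L = split x (Function.update S k L) p := by
  funext j
  by_cases e₁ : j = k
  · subst e₁
    simp [split, h₁, h₂]
  · by_cases e₂ : j = .arr x
    · subst e₂
      simp [split, h₁.symm]
    · by_cases e₃ : j = .aux₃
      · subst e₃
        simp [split, h₁.symm, h₂.symm]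
      · simp [split, e₁, e₂, e₃]

theorem split_zero (x : Fin 4) (S : Stk → List Sym) (h : S .aux₃ = []) : split x S 0 = S := by
  funext j
  by_cases e₂ : j = .arr x
  · subst e₂
    simp [split]
  · by_cases e₃ : j = .aux₃
    · subst e₃
      simp [split, h]
    · simp [split, e₃]

theorem runs_shift (x : Fin 4) (S : Stk → List Sym) (p : ℕ) (hp : p < (S (.arr x)).length) :
    Runs (shift (.arr x) .aux₃) (split x S p) (split x S (p + 1)) 2 := by
  have hd : (S (.arr x)).drop p = (S (.arr x))[p] :: (S (.arr x)).drop (p + 1) :=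
    List.drop_eq_getElem_cons hp
  have h : split x S p (.arr x) = (S (.arr x))[p] :: (S (.arr x)).drop (p + 1) := by
    simp [split, hd, -List.getElem_cons_drop]
  refine Runs.popCase ?_
  rw [h]
  refine (runs_push _ _ _).congr rfl ?_ le_rfl
  have ht : (S (.arr x)).take (p + 1) = (S (.arr x)).take p ++ [(S (.arr x))[p]] := by
    rw [List.take_add_one, List.getElem?_eq_getElem hp, Option.toList_some]
  funext j
  by_cases e₂ : j = .arr x
  · subst e₂
    simp [split]
  · by_cases e₃ : j = .aux₃
    · subst e₃
      simp only [split, ht, Function.update_self, Function.update_of_ne e₂,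
        List.reverse_append, List.reverse_cons, List.reverse_nil, List.nil_append,
        List.cons_append]
    · simp [split, e₂, e₃]

/-- Shift the entries before the entry with indices `i`, `j` to the scratch stack. -/
def seek (x : Fin 4) (i j : Fin 5) : Prog Stk Sym :=
  (forEach (.var i) .aux₁ (forEach .cnt .aux₂ (shift (.arr x) .aux₃))).seq
    (forEach (.var j) .aux₁ (shift (.arr x) .aux₃))

theorem runs_forEach_shift (x : Fin 4) {k h : Stk} (hk : h ≠ k) (hkx : k ≠ .arr x)
    (hkx' : k ≠ .aux₃) (hhx : h ≠ .arr x) (hhx' : h ≠ .aux₃) (S : Stk → List Sym) (p : ℕ)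
    (hp : p + (S k).length ≤ (S (.arr x)).length) (hh : S h = []) :
    Runs (forEach k h (shift (.arr x) .aux₃)) (split x S p) (split x S (p + (S k).length))
      ((S k).length * 6 + 2) := by
  refine runs_forEach hk (t := 2) (fun i => split x S (p + i)) (S k) ?_ ?_ ?_
  · simp [split, hkx, hkx']
  · simp [split, hhx, hhx', hh]
  · intro i hi l l'
    simp only [split_update x _ _ _ hkx hkx', split_update x _ _ _ hhx hhx']
    exact runs_shift x _ _ (by simp [hkx.symm, hhx.symm]; lia)

/-- Position `env i * n + env j` is reached without arithmetic: `env i` rounds of `n` shifts, then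
`env j` shifts. -/
theorem runs_seek {n d : ℕ} {env : Fin 5 → ℕ} (hs : Scoped d n env) (M : Mem) (B C : List Sym)
    (x : Fin 4) {i j : Fin 5} (hi : i.val < d) (hj : j.val < d) :
    Runs (seek x i j) (store n env M B C) (split x (store n env M B C)
      (env i * n + env j)) (n * (n * 6 + 6) + 2 + (n * 6 + 2)) := by
  have li := (hs i).1 hi
  have lj := (hs j).1 hj
  have hb : env i * n + n ≤ n * n := by nlinarith
  refine Runs.seq (S₁ := split x (store n env M B C) (env i * n)) ?_ ?_
  · have := runs_forEach (k := .var i) (h := .aux₁) (by simp)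
      (p := forEach .cnt .aux₂ (shift (.arr x) .aux₃)) (t := n * 6 + 2)
      (fun r => split x (store n env M B C) (r * n)) (unary (env i)) ?_ ?_ ?_
    · refine this.congr ?_ ?_ ?_
      · rw [zero_mul, split_zero _ _ rfl]
      · simp
      · rw [unary_length]
        gcongr
    · simp [split, store]
    · simp [split, store]
    · intro r hr l l'
      rw [unary_length] at hr
      have h₁ : (store n env M B C (.arr x)).length = n * n := by simp [store]
      have h₂ : (r + 1) * n ≤ n * n := Nat.mul_le_mul_right n (by lia)
      simp only [split_update x _ _ _ (k := .var i) (by simp) (by simp),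
        split_update x _ _ _ (k := .aux₁) (by simp) (by simp)]
      have h₃ := runs_forEach_shift x (k := .cnt) (h := .aux₂) (by simp) (by simp) (by simp)
        (by simp) (by simp) (Function.update (Function.update (store n env M B C) (.var i) l)
          .aux₁ l') (r * n) (by simp [store]; linarith) (by simp [store])
      refine h₃.congr rfl ?_ ?_
      · simp [store, add_mul]
      · simp [store]
  · refine (runs_forEach_shift x (k := .var j) (h := .aux₁) (by simp) (by simp) (by simp)
      (by simp) (by simp) _ _ (by simp [store]; lia) (by simp [store])).congr rfl ?_ ?_
    · simp [store]
    · simp [store]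
      lia

/-- Moving back undoes the reversal on the scratch stack. The rest `L` is arbitrary, so the lemma
serves reading and writing alike. -/
theorem runs_restore (x : Fin 4) (S : Stk → List Sym) (p : ℕ) (L : List Sym)
    (h : S .aux₃ = []) :
    Runs (move .aux₃ (.arr x)) (Function.update (split x S p) (.arr x) L)
      (Function.update S (.arr x) ((S (.arr x)).take p ++ L)) (2 * p + 1) := by
  refine (runs_move (by simp) _).congr rfl ?_ ?_
  · funext j
    by_cases e₂ : j = .arr x
    · subst e₂
      simp [split]
    · by_cases e₃ : j = .aux₃
      · subst e₃
        simp [h]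
      · simp [split, e₂, e₃]
  · simp [split]

/-- Evaluate the entry of the matrix `x` with indices `i`, `j`. -/
def getProg (x : Fin 4) (i j : Fin 5) : Prog Stk Sym :=
  (seek x i j).seq ((popCase (.arr x) fun o =>
    (push (.arr x) (o.getD none)).seq (push .ev (o.getD none))).seq (move .aux₃ (.arr x)))

theorem entries_getElem (n : ℕ) (a : ℕ → Bool) (p : ℕ) (hp : p < (entries n a).length) :
    (entries n a)[p] = some (a p) := by
  simp [entries]

theorem runs_getProg {n d : ℕ} {env : Fin 5 → ℕ} (hs : Scoped d n env) (M : Mem)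
    (B C : List Sym) (x : Fin 4) {i j : Fin 5} (hi : i.val < d) (hj : j.val < d) :
    Runs (getProg x i j) (store n env M B C)
      (store n env M (some (M.arr x (env i * n + env j)) :: B) C)
      (n * (n * 6 + 6) + 2 + (n * 6 + 2) + (3 + (2 * (n * n) + 1))) := by
  have li := (hs i).1 hi
  have lj := (hs j).1 hj
  have hb : env i * n + n ≤ n * n := by nlinarith
  have h₀ := runs_seek hs M B C x hi hj
  have hlen : env i * n + env j < (entries n (M.arr x)).length := by
    rw [entries_length]
    lia
  generalize env i * n + env j = p at h₀ hlen ⊢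
  set S := store n env M B C with hS
  set S' := store n env M (some (M.arr x p) :: B) C with hS'
  have hd : (entries n (M.arr x)).drop p =
      some (M.arr x p) :: (entries n (M.arr x)).drop (p + 1) := by
    rw [List.drop_eq_getElem_cons hlen, entries_getElem]
  refine h₀.seq (Runs.seq (S₁ := split x S' p) ?_ ?_)
  · refine Runs.popCase ?_
    refine (Runs.seq (runs_push _ _ _) (runs_push _ _ _)).congr rfl ?_ le_rfl
    have e : split x S p (.arr x) = some (M.arr x p) :: (entries n (M.arr x)).drop (p + 1) := by
      simp [split, hS, store, hd]
    rw [e]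
    funext k
    by_cases e₂ : k = .arr x
    · subst e₂
      simp [split, hS', store, hd]
    · by_cases e₃ : k = .ev
      · subst e₃
        simp [split, hS, hS', store]
      · cases k <;> simp_all [split, store]
  · refine (runs_restore x S' p ((entries n (M.arr x)).drop p) rfl).congr ?_ ?_ ?_
    · rw [eq_comm, Function.update_eq_self_iff]
      simp [split, hS', store]
    · simp [hS', store]
    · rw [entries_length] at hlen
      lia

/-- Store the value on the evaluation stack as the entry of `x` with indices `i`, `j`. -/
def setProg (x : Fin 4) (i j : Fin 5) : Prog Stk Sym :=
  (seek x i j).seq ((popCase .ev fun o =>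
    popCase (.arr x) fun _ => push (.arr x) (o.getD none)).seq (move .aux₃ (.arr x)))

/-- The memory with an entry of the matrix `x` changed. -/
def Mem.set (M : Mem) (x : Fin 4) (p : ℕ) (b : Bool) : Mem :=
  { M with arr := Function.update M.arr x (Function.update (M.arr x) p b) }

theorem entries_update (n : ℕ) (a : ℕ → Bool) (p : ℕ) (b : Bool) (hp : p < n * n) :
    entries n (Function.update a p b) =
      (entries n a).take p ++ some b :: (entries n a).drop (p + 1) := by
  have hs := List.set_eq_take_append_cons_drop (l := entries n a) (i := p) (a := some b)
  rw [if_pos (by simpa using hp)] at hs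
  rw [← hs]
  refine List.ext_getElem (by simp) fun i h₁ h₂ => ?_
  rw [entries_getElem, List.getElem_set, entries_getElem]
  by_cases h : p = i
  · subst h
    simp
  · rw [if_neg h, Function.update_of_ne (Ne.symm h)]

theorem runs_setProg {n d : ℕ} {env : Fin 5 → ℕ} (hs : Scoped d n env) (M : Mem) (b : Bool)
    (B C : List Sym) (x : Fin 4) {i j : Fin 5} (hi : i.val < d) (hj : j.val < d) :
    Runs (setProg x i j) (store n env M (some b :: B) C)
      (store n env (M.set x (env i * n + env j) b) B C)
      (n * (n * 6 + 6) + 2 + (n * 6 + 2) + (3 + (2 * (n * n) + 1))) := by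
  have li := (hs i).1 hi
  have lj := (hs j).1 hj
  have hb : env i * n + n ≤ n * n := by nlinarith
  have h₀ := runs_seek hs M (some b :: B) C x hi hj
  have hlen : env i * n + env j < n * n := by lia
  generalize env i * n + env j = p at h₀ hlen ⊢
  set S' := store n env M B C with hS'
  refine h₀.seq (Runs.seq (S₁ := Function.update (split x S' p)
    (.arr x) (some b :: (entries n (M.arr x)).drop (p + 1))) ?_ ?_)
  · refine (Runs.popCase (Runs.popCase (runs_push _ _ _))).congr rfl ?_ le_rfl
    funext k
    cases k with
    | arr y => by_cases h : y = x <;> simp [split, hS', store, h]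
    | _ => simp [split, hS', store]
  · refine (runs_restore x S' p _ rfl).congr rfl ?_ (by lia)
    funext k
    cases k with
    | arr y =>
      by_cases h : y = x
      · subst h
        simp [hS', store, Mem.set, entries_update _ _ _ _ hlen]
      · simp [hS', store, Mem.set, h]
    | _ => simp [hS', store, Mem.set]

/-! ### Polynomial-time expressions and commands -/

/-- `E` is evaluated in polynomial time by a program that leaves its value on the evaluation
stack. -/
def IsExpr (d : ℕ) (E : ℕ → (Fin 5 → ℕ) → Mem → Bool) : Prop :=
  ∃ (p : Prog Stk Sym) (T : ℕ[X]), ∀ n env M B C, Scoped d n env →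
    Runs p (store n env M B C) (store n env M (some (E n env M) :: B) C) (T.eval n)

/-- Like `IsExpr`, but the counter has to be empty. -/
def IsGuard (d : ℕ) (E : ℕ → (Fin 5 → ℕ) → Mem → Bool) : Prop :=
  ∃ (p : Prog Stk Sym) (T : ℕ[X]), ∀ n env M B, Scoped d n env →
    Runs p (store n env M B []) (store n env M (some (E n env M) :: B) []) (T.eval n)

/-- `f` is a transformation of the memory performed by a program in polynomial time. -/
def IsCmd (d : ℕ) (f : ℕ → (Fin 5 → ℕ) → Mem → Mem) : Prop :=
  ∃ (p : Prog Stk Sym) (T : ℕ[X]), ∀ n env M, Scoped d n env →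
    Runs p (store n env M [] []) (store n env (f n env M) [] []) (T.eval n)

theorem IsExpr.isGuard {d : ℕ} {E : ℕ → (Fin 5 → ℕ) → Mem → Bool} (h : IsExpr d E) :
    IsGuard d E :=
  let ⟨p, T, hp⟩ := h
  ⟨p, T, fun n env M B hs => hp n env M B [] hs⟩

theorem isExpr_get {d : ℕ} (x : Fin 4) {i j : Fin 5} (hi : i.val < d) (hj : j.val < d) :
    IsExpr d fun n env M => M.arr x (env i * n + env j) :=
  ⟨getProg x i j, X * (X * 6 + 6) + 2 + (X * 6 + 2) + (3 + (2 * (X * X) + 1)),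
    fun n env M B C hs => (runs_getProg hs M B C x hi hj).mono (by simp)⟩

theorem IsExpr.bool₂ {d : ℕ} {E₁ E₂ : ℕ → (Fin 5 → ℕ) → Mem → Bool} (h₁ : IsExpr d E₁)
    (h₂ : IsExpr d E₂) (g : Bool → Bool → Bool) :
    IsExpr d fun n env M => g (E₁ n env M) (E₂ n env M) := by
  obtain ⟨p₁, T₁, hp₁⟩ := h₁
  obtain ⟨p₂, T₂, hp₂⟩ := h₂
  -- The second value lies on top and is popped first; the defaults of `getD` are never reached.
  refine ⟨p₁.seq (p₂.seq (popCase .ev fun o₂ => popCase .ev fun o₁ =>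
    push .ev (some (g ((o₁.getD none).getD false) ((o₂.getD none).getD false))))),
    T₁ + (T₂ + 3), fun n env M B C hs => ?_⟩
  refine ((hp₁ n env M B C hs).seq ((hp₂ n env M _ C hs).seq
    (Runs.popCase (Runs.popCase (runs_push _ _ _))))).congr rfl ?_ (by simp)
  simp [update_ev, store]

theorem IsExpr.and {d : ℕ} {E₁ E₂ : ℕ → (Fin 5 → ℕ) → Mem → Bool} (h₁ : IsExpr d E₁)
    (h₂ : IsExpr d E₂) : IsExpr d fun n env M => E₁ n env M && E₂ n env M :=
  h₁.bool₂ h₂ _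

theorem IsExpr.or {d : ℕ} {E₁ E₂ : ℕ → (Fin 5 → ℕ) → Mem → Bool} (h₁ : IsExpr d E₁)
    (h₂ : IsExpr d E₂) : IsExpr d fun n env M => E₁ n env M || E₂ n env M :=
  h₁.bool₂ h₂ _

theorem IsExpr.not {d : ℕ} {E : ℕ → (Fin 5 → ℕ) → Mem → Bool} (h : IsExpr d E) :
    IsExpr d fun n env M => !E n env M :=
  h.bool₂ h fun a _ => !a

theorem isCmd_set {d : ℕ} (x : Fin 4) {i j : Fin 5} (hi : i.val < d) (hj : j.val < d) (b : Bool) :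
    IsCmd d fun n env M => M.set x (env i * n + env j) b := by
  refine ⟨(push .ev (some b)).seq (setProg x i j),
    1 + (X * (X * 6 + 6) + 2 + (X * 6 + 2) + (3 + (2 * (X * X) + 1))),
    fun n env M hs => (((runs_push _ _ _).congr rfl (update_ev _ _ _ _ _ _) le_rfl).seq
      (runs_setProg hs M b [] [] x hi hj)).mono (by simp)⟩

theorem IsCmd.seq {d : ℕ} {f g : ℕ → (Fin 5 → ℕ) → Mem → Mem} (hf : IsCmd d f)
    (hg : IsCmd d g) : IsCmd d fun n env M => g n env (f n env M) := by
  obtain ⟨p₁, T₁, hp₁⟩ := hf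
  obtain ⟨p₂, T₂, hp₂⟩ := hg
  exact ⟨p₁.seq p₂, T₁ + T₂, fun n env M hs =>
    ((hp₁ n env M hs).seq (hp₂ n env _ hs)).mono (by simp)⟩

/-- Run `p` if the value on the evaluation stack is `true`. -/
def whenTrue (p : Prog Stk Sym) : Prog Stk Sym :=
  popCase .ev fun o => match o with
    | some (some true) => p
    | _ => skip

theorem runs_whenTrue {p : Prog Stk Sym} {n : ℕ} {env : Fin 5 → ℕ} {M : Mem} {b : Bool}
    {B C : List Sym} {S : Stk → List Sym} {t : ℕ}
    (h₁ : b = true → Runs p (store n env M B C) S (t + 1))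
    (h₂ : b = false → store n env M B C = S) :
    Runs (whenTrue p) (store n env M (some b :: B) C) S (t + 2) := by
  refine Runs.popCase ?_
  rw [update_ev]
  cases b
  · exact (runs_skip _).congr rfl (h₂ rfl) (Nat.le_add_left _ _)
  · exact h₁ rfl

theorem IsCmd.ite {d : ℕ} {E : ℕ → (Fin 5 → ℕ) → Mem → Bool}
    {f : ℕ → (Fin 5 → ℕ) → Mem → Mem} (hE : IsGuard d E) (hf : IsCmd d f) :
    IsCmd d fun n env M => if E n env M then f n env M else M := by
  obtain ⟨p₁, T₁, hp₁⟩ := hE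
  obtain ⟨p₂, T₂, hp₂⟩ := hf
  refine ⟨p₁.seq (whenTrue p₂), T₁ + (T₂ + 2), fun n env M hs => ?_⟩
  refine ((hp₁ n env M [] hs).seq (runs_whenTrue (t := T₂.eval n) (fun h => ?_)
    fun h => ?_)).mono (by simp)
  · simp only [if_pos h]
    exact (hp₂ n env M hs).mono (Nat.le_succ _)
  · simp [h]

theorem isCmd_emit_sep (d : ℕ) : IsCmd d fun _ _ M => { M with out := none :: M.out } :=
  ⟨push .out none, 1, fun n env M _ => (runs_push _ _ _).congr rfl
    (update_out _ _ _ _ _ _) (by simp)⟩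

theorem IsExpr.emit {d : ℕ} {E : ℕ → (Fin 5 → ℕ) → Mem → Bool} (h : IsExpr d E) :
    IsCmd d fun n env M => { M with out := some (E n env M) :: M.out } := by
  obtain ⟨p, T, hp⟩ := h
  refine ⟨p.seq (popCase .ev fun o => push .out (o.getD none)), T + 2, fun n env M hs => ?_⟩
  refine ((hp n env M [] [] hs).seq (Runs.popCase (runs_push _ _ _))).congr rfl ?_ (by simp)
  simp [update_ev, update_out, store]

/-- Apply `g (n - 1)`, …, `g 0`, in this order. -/
def forDown {α : Type*} (g : ℕ → α → α) : ℕ → α → α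
  | 0, a => a
  | i + 1, a => forDown g i (g i a)

theorem forDown_induction {α : Type*} {g : ℕ → α → α} (P : ℕ → α → Prop) {n : ℕ} {a : α}
    (h₀ : P n a) (h : ∀ i < n, ∀ a, P (i + 1) a → P i (g i a)) : P 0 (forDown g n a) := by
  induction n generalizing a with
  | zero => exact h₀
  | succ n ih => exact ih (h n n.lt_succ_self a h₀) fun i hi => h i (hi.trans n.lt_succ_self)

/-- Set the variable `w` to `n`. -/
def initVar (w : Fin 5) : Prog Stk Sym := forEach .cnt .aux₁ (push (.var w) (some true))

theorem runs_initVar (n : ℕ) (env : Fin 5 → ℕ) (M : Mem) (B C : List Sym) (w : Fin 5)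
    (hw : env w = 0) : Runs (initVar w) (store n env M B C)
      (store n (Function.update env w n) M B C) (n * 5 + 2) := by
  have := runs_forEach (k := Stk.cnt) (h := .aux₁) (by simp) (p := push (.var w) (some true))
    (t := 1) (fun i => store n (Function.update env w i) M B C) (unary n)
    (fun _ => rfl) (fun _ => rfl) ?_
  · refine this.congr ?_ ?_ ?_
    · rw [← hw, Function.update_eq_self]
    · simp
    · simp
  · intro i _ l l'
    refine (runs_push _ _ _).congr rfl ?_ le_rfl
    funext k
    cases k with
    | var j =>
      by_cases h : j = w
      · subst h
        simp [store, unary_succ]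
      · simp [store, h]
    | _ => simp [store, Function.update]

/-- The loop pops its unary variable before each round, so the body sees `n - 1`, …, `0`. The
variable ends empty, as `Scoped` requires of variables not in use. -/
theorem IsCmd.for {d : ℕ} {f : ℕ → (Fin 5 → ℕ) → Mem → Mem} (w : Fin 5) (hw : w.val = d)
    (hf : IsCmd (d + 1) f) :
    IsCmd d fun n env M => forDown (fun i M => f n (Function.update env w i) M) n M := by
  obtain ⟨p, T, hp⟩ := hf
  refine ⟨(initVar w).seq (popWhile (.var w) fun _ => p), X * 5 + 2 + (X * (T + 1) + 1),
    fun n env M hs => ?_⟩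
  have hw₀ : env w = 0 := (hs w).2 hw.ge
  have key : ∀ m ≤ n, ∀ M, Runs (popWhile (.var w) fun _ => p)
      (store n (Function.update env w m) M [] [])
      (store n (Function.update env w 0)
        (forDown (fun i M => f n (Function.update env w i) M) m M) [] [])
      (m * (T.eval n + 1) + 1) := by
    intro m
    induction m with
    | zero => exact fun _ M => (runs_popWhile_nil (by simp [store])).mono (by simp)
    | succ m ih =>
      intro hm M
      refine (Runs.popWhile_cons (a := some true) (l := unary m) (by simp [store, unary_succ])
        ?_ (ih (by lia) _)).mono (t := T.eval n + (m * (T.eval n + 1) + 1) + 1) (by lia)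
      have := hp n (Function.update env w m) M (hs.update hw hm)
      rwa [update_var, Function.update_idem]
  refine ((runs_initVar n env M [] [] w hw₀).seq (key n le_rfl M)).congr rfl ?_ (by simp)
  rw [← hw₀, Function.update_eq_self]

theorem countP_range_succ (q : ℕ → Bool) (m : ℕ) :
    (List.range (m + 1)).countP q = (List.range m).countP q + if q m then 1 else 0 := by
  rw [List.range_succ, List.countP_append, List.countP_singleton]

/-- The counter receives `env t + 1` symbols and loses one per success, so it is empty at the end
exactly if there are more than `env t` successes. Since `E` is evaluated while the counter is in
use, it has to be an `IsExpr`, and the result is only an `IsGuard`. -/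
theorem IsExpr.count {d : ℕ} {E : ℕ → (Fin 5 → ℕ) → Mem → Bool} (t w : Fin 5) (hw : w.val = d)
    (hE : IsExpr (d + 1) E) :
    IsGuard d fun n env M => decide (env t <
      (List.range n).countP fun i => E n (Function.update env w i) M) := by
  obtain ⟨p, T, hp⟩ := hE
  refine ⟨((forEach (.var t) .aux₁ (push .ctr (some true))).seq (push .ctr (some true))).seq
    ((initVar w).seq ((popWhile (.var w) fun _ => p.seq (whenTrue (popCase .ctr fun _ => skip))).seq
      (popCase .ctr fun o => if o = none then push .ev (some true) else
        (popWhile .ctr fun _ => skip).seq (push .ev (some false))))),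
    (X * 5 + 2 + 1) + (X * 5 + 2 + ((X * (T + 4) + 1) + (X * 2 + 4))), fun n env M B hs => ?_⟩
  have hw₀ : env w = 0 := (hs w).2 hw.ge
  have h₁ : Runs ((forEach (.var t) .aux₁ (push .ctr (some true))).seq (push .ctr (some true)))
      (store n env M B []) (store n env M B (unary (env t + 1))) (n * 5 + 2 + 1) := by
    have := runs_forEach (k := Stk.var t) (h := .aux₁) (by simp) (p := push .ctr (some true))
      (t := 1) (fun i => store n env M B (unary i)) (unary (env t))
      (fun _ => rfl) (fun _ => rfl) ?_
    · refine ((this.congr rfl rfl (t' := n * 5 + 2) ?_).seq (runs_push _ _ _)).congr rfl ?_ le_rfl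
      · have := hs.le t
        rw [unary_length]
        lia
      · rw [update_ctr]
        simp [store, unary_succ]
    · intro i _ l l'
      refine (runs_push _ _ _).congr rfl ?_ le_rfl
      funext k
      cases k <;> simp [store, Function.update, unary_succ]
  have h₂ : ∀ m ≤ n, ∀ C, Runs (popWhile (.var w) fun _ => p.seq (whenTrue (popCase .ctr fun _ => skip)))
      (store n (Function.update env w m) M B C)
      (store n (Function.update env w 0) M B (C.drop
        ((List.range m).countP fun i => E n (Function.update env w i) M)))
      (m * (T.eval n + 4) + 1) := by
    intro m
    induction m with
    | zero => exact fun _ C => (runs_popWhile_nil (by simp [store])).mono (by simp)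
    | succ m ih =>
      intro hm C
      rw [countP_range_succ]
      refine (Runs.popWhile_cons (a := some true) (l := unary m) (by simp [store, unary_succ])
        (Runs.seq (t₁ := T.eval n) (t₂ := 3) (S₁ := store n (Function.update env w m) M
          (some (E n (Function.update env w m) M) :: B) C) ?_ ?_)
        (ih (by lia) (C.drop (if E n (Function.update env w m) M then 1 else 0)))).congr rfl
        ?_ (by lia)
      · have := hp n (Function.update env w m) M B C (hs.update hw hm)
        rwa [update_var, Function.update_idem]
      · refine runs_whenTrue (t := 1) (fun h => ?_) fun h => ?_
        · refine Runs.popCase ((runs_skip _).congr rfl ?_ le_rfl)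
          rw [update_ctr, if_pos h, List.drop_one]
          rfl
        · rw [if_neg (by simp [h]), List.drop_zero]
      · rw [List.drop_drop, add_comm]
  refine (h₁.seq ((runs_initVar n env M B _ w hw₀).seq ((h₂ n le_rfl _).seq
    (t₂ := n * 2 + 4) (Runs.popCase (t := n * 2 + 3) (S₁ := store n env M (some (decide (env t <
      (List.range n).countP fun i => E n (Function.update env w i) M)) :: B) []) ?_)))).congr
    rfl rfl (by simp)
  rw [update_ctr, ← hw₀, Function.update_eq_self]
  generalize (List.range n).countP (fun i => E n (Function.update env w i) M) = c
  have hd : (unary (env t + 1)).drop c = unary (env t + 1 - c) := List.drop_replicate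
  rw [hd]
  rcases lt_or_ge (env t) c with hc | hc
  · have : env t + 1 - c = 0 := by lia
    simp only [this, hc, store]
    refine (runs_push _ _ _).congr rfl ?_ (by lia)
    rw [update_ev]
    rfl
  · obtain ⟨r, hr⟩ : ∃ r, env t + 1 - c = r + 1 := ⟨env t - c, by lia⟩
    have hrn : r ≤ n := by
      have := hs.le t
      lia
    simp only [hr, hc.not_gt, store, unary_succ, List.head?_cons, List.tail_cons, decide_false,
      reduceCtorEq, if_false]
    have h₃ : ∀ r, Runs (popWhile Stk.ctr fun _ => skip) (store n env M B (unary r))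
        (store n env M B []) (r * 2 + 1) := by
      intro r
      induction r with
      | zero => exact runs_popWhile_nil rfl
      | succ r ih =>
        refine (Runs.popWhile_cons (S := store n env M B (unary (r + 1))) (k := Stk.ctr)
          (a := some true) (l := unary r) rfl ((runs_skip _).congr rfl (update_ctr _ _ _ _ _ _)
          le_rfl) ih).mono (by lia)
    exact ((h₃ r).seq (runs_push _ _ _)).congr rfl (update_ev _ _ _ _ _ _) (by lia)

/-! ### Reading the input and writing the output -/

/-- The rows of a matrix, stored as a function, each followed by a separator. -/
def encodeRows (n : ℕ) (a : ℕ → Bool) : List Sym :=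
  (List.range n).flatMap fun i => (List.range n).map (fun j => some (a (i * n + j))) ++ [none]

theorem encodeRel_eq_encodeRows {n : ℕ} {r : Fin n → Fin n → Prop} {a : ℕ → Bool}
    (h : ∀ i j : Fin n, a (i * n + j) = true ↔ r i j) : encodeRel n r = encodeRows n a := by
  classical
  have h' : ∀ i j : Fin n, a (i * n + j) = decide (r i j) := fun i j => by
    rw [Bool.eq_iff_iff, h, decide_eq_true_iff]
  rw [encodeRel, encodeRows, ← List.map_coe_finRange_eq_range, List.flatMap_map]
  congr 1
  funext i
  rw [List.map_map]
  congr 1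
  refine List.map_congr_left fun j _ => ?_
  simp only [Function.comp_apply, h']

theorem encodeRows_length (n : ℕ) (a : ℕ → Bool) : (encodeRows n a).length = n * (n + 1) := by
  simp [encodeRows, List.length_flatMap]

theorem encodeRows_count (n : ℕ) (a : ℕ → Bool) : (encodeRows n a).count none = n := by
  have h : ∀ (s : List ℕ) (f : ℕ → Bool), (s.map fun j => some (f j)).count none = 0 := by
    intro s f
    rw [List.count_eq_zero]
    simp
  rw [encodeRows, List.count_flatMap]
  simp [Function.comp_def, h]

theorem map_range_mul {β : Type*} (m n : ℕ) (g : ℕ → β) :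
    (List.range (m * n)).map g =
      (List.range m).flatMap fun i => (List.range n).map fun j => g (i * n + j) := by
  induction m with
  | zero => simp
  | succ m ih => simp [add_mul, List.range_add, ih, List.range_succ, List.flatMap_append]

theorem encodeRows_filter (n : ℕ) (a : ℕ → Bool) :
    (encodeRows n a).filter Option.isSome = entries n a := by
  have h : ∀ (s : List ℕ) (f : ℕ → Bool),
      (s.map fun j => some (f j)).filter Option.isSome = s.map fun j => some (f j) := by
    intro s f
    rw [List.filter_eq_self]
    simp
  rw [encodeRows, entries, map_range_mul, List.filter_flatMap]
  simp [h]

/-- Split the input into the entries of the matrix and its order. -/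
def splitProg : Prog Stk Sym :=
  popWhile .inp fun o => if o = none then push .cnt (some true) else push .aux₁ o

/-- Only the input, the order and one scratch stack are in use. -/
def splitStore (l c b : List Sym) : Stk → List Sym
  | .inp => l
  | .cnt => c
  | .aux₁ => b
  | _ => []

theorem runs_splitProg (l b : List Sym) (c : ℕ) :
    Runs splitProg (splitStore l (unary c) b)
      (splitStore [] (unary (l.count none + c)) ((l.filter Option.isSome).reverse ++ b))
      (l.length * 2 + 1) := by
  induction l generalizing c b with
  | nil => exact (runs_popWhile_nil rfl).congr rfl (by simp) (by simp)
  | cons a l ih =>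
    have e₁ : Function.update (splitStore (a :: l) (unary c) b) .inp l =
        splitStore l (unary c) b := by
      funext k
      cases k <;> simp [splitStore, Function.update]
    rcases a with _ | a
    · have h₁ : Runs (push .cnt (some true)) (splitStore l (unary c) b)
          (splitStore l (unary (c + 1)) b) 1 := by
        refine (runs_push _ _ _).congr rfl ?_ le_rfl
        funext k
        cases k <;> simp [splitStore, Function.update, unary_succ]
      refine (Runs.popWhile_cons (k := Stk.inp) (S := splitStore (none :: l) (unary c) b)
        (a := none) (l := l) (t₁ := 1) rfl ?_ (ih b (c + 1))).congr rfl
        ?_ (by simp; lia)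
      · rw [e₁]
        exact h₁
      · simp [add_comm, add_assoc]
    · have h₁ : Runs (push .aux₁ (some a)) (splitStore l (unary c) b)
          (splitStore l (unary c) (some a :: b)) 1 := by
        refine (runs_push _ _ _).congr rfl ?_ le_rfl
        funext k
        cases k <;> simp [splitStore, Function.update]
      refine (Runs.popWhile_cons (k := Stk.inp) (S := splitStore (some a :: l) (unary c) b)
        (a := some a) (l := l) (t₁ := 1) rfl ?_ (ih (some a :: b) c)).congr rfl ?_ (by simp; lia)
      · rw [e₁]
        exact h₁
      · simp

/-- Load the entries into the first matrix; the others are initialized with `false`. -/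
def loadProg : Prog Stk Sym :=
  popWhile .aux₁ fun o => ((push (.arr 0) o).seq (push (.arr 1) (some false))).seq
    ((push (.arr 2) (some false)).seq (push (.arr 3) (some false)))

/-- The entries `L` are already loaded, the entries `b` are still to be loaded. -/
def loadStore (c b L : List Sym) : Stk → List Sym
  | .cnt => c
  | .aux₁ => b
  | .arr i => if i = 0 then L else List.replicate L.length (some false)
  | _ => []

theorem runs_loadProg (c b L : List Sym) :
    Runs loadProg (loadStore c b L) (loadStore c [] (b.reverse ++ L)) (b.length * 5 + 1) := by
  induction b generalizing L with
  | nil => exact (runs_popWhile_nil rfl).congr rfl (by simp) (by simp)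
  | cons a b ih =>
    refine (Runs.popWhile_cons (a := a) (l := b) rfl (t₁ := 4) (S₁ := loadStore c b (a :: L)) ?_
      (ih (a :: L))).congr rfl ?_ (by simp; lia)
    · refine (((runs_push _ _ _).seq (runs_push _ _ _)).seq
        ((runs_push _ _ _).seq (runs_push _ _ _))).congr rfl ?_ le_rfl
      funext k
      cases k with
      | arr i =>
        fin_cases i <;> simp [loadStore, Function.update, List.replicate_succ]
      | _ => simp [loadStore, Function.update]
    · simp

/-- The memory with the first matrix given and all other matrices `false`. -/
def Mem.init (a : ℕ → Bool) : Mem := ⟨fun i => if i = 0 then a else fun _ => false, []⟩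

theorem loadStore_eq (n : ℕ) (a : ℕ → Bool) :
    loadStore (unary n) [] (entries n a) = store n 0 (Mem.init a) [] [] := by
  funext k
  cases k with
  | arr i =>
    by_cases h : i = 0
    · simp [loadStore, store, Mem.init, h]
    · simp [loadStore, store, Mem.init, h, entries]
  | _ => simp [loadStore, store, Mem.init]

/-- Empty a stack. -/
def clear (k : Stk) : Prog Stk Sym := popWhile k fun _ => skip

theorem runs_clear (k : Stk) (S : Stk → List Sym) :
    Runs (clear k) S (Function.update S k []) ((S k).length * 2 + 1) := by
  generalize hL : S k = L
  induction L generalizing S with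
  | nil => exact (runs_popWhile_nil hL).congr rfl (by rw [← hL, Function.update_eq_self]) (by simp)
  | cons a l ih =>
    exact (Runs.popWhile_cons hL (runs_skip _) (ih (Function.update S k l) (by simp))).congr rfl
      (by simp) (by simp; lia)

/-- Empty all stacks except the output. -/
def clearProg : Prog Stk Sym :=
  (clear .cnt).seq (((clear (.arr 0)).seq (clear (.arr 1))).seq
    ((clear (.arr 2)).seq (clear (.arr 3))))

theorem runs_clearProg (n : ℕ) (M : Mem) :
    Runs clearProg (store n 0 M [] []) (Function.update (fun _ => []) .out M.out)
      (n * 2 + n * n * 8 + 5) := by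
  refine ((runs_clear _ _).seq (((runs_clear _ _).seq (runs_clear _ _)).seq
    ((runs_clear _ _).seq (runs_clear _ _)))).congr rfl ?_ ?_
  · funext k
    cases k with
    | arr i => fin_cases i <;> simp [Function.update]
    | _ => simp [store, Function.update]
  · simp [store, Function.update]
    lia

/-- The coefficients are natural numbers. This turns bounds in the order `n` into bounds in the
input length `n * (n + 1)`. -/
theorem eval_mono (T : ℕ[X]) {m n : ℕ} (h : m ≤ n) : T.eval m ≤ T.eval n := by
  rw [eval_eq_sum, eval_eq_sum]
  exact Finset.sum_le_sum fun i _ => Nat.mul_le_mul_left _ (Nat.pow_le_pow_left h i)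

/-- A map is computed in polynomial time if a polynomial-time transformation of the memory
takes the adjacency matrix of a graph to the output of the map. -/
theorem IsCmd.isPolyTime {f : ℕ → (Fin 5 → ℕ) → Mem → Mem} (hf : IsCmd 0 f)
    {A : ∀ n : ℕ, SimpleGraph (Fin n) → Finset (Sym2 (Fin n))}
    (hA : ∀ n (G : SimpleGraph (Fin n)), ∃ a : ℕ → Bool,
      (∀ i j : Fin n, a (i * n + j) = true ↔ G.Adj i j) ∧
      (f n 0 (Mem.init a)).out = encodePairSet ⟨n, A n G⟩) : IsPolyTime A := by
  obtain ⟨p, T, hp⟩ := hf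
  refine ⟨{
    tm := machine (splitProg.seq (loadProg.seq (p.seq clearProg))) .inp .out
    inputAlphabet := Equiv.refl _
    outputAlphabet := Equiv.refl _
    time := X * 2 + 1 + (X * 5 + 1 + (T + (X * 10 + 5))) + 1
    outputsFun := fun G => Classical.choice ?_ }⟩
  obtain ⟨n, G⟩ := G
  obtain ⟨a, ha, hout⟩ := hA n G
  have hin : encodeGraph ⟨n, G⟩ = encodeRows n a := encodeRel_eq_encodeRows ha
  have h₁ := runs_splitProg (encodeRows n a) [] 0
  have h₂ := runs_loadProg (unary n) (entries n a).reverse []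
  rw [encodeRows_filter, encodeRows_count, List.append_nil, add_zero] at h₁
  rw [List.reverse_reverse, List.append_nil, loadStore_eq] at h₂
  have h₃ := hp n 0 (Mem.init a) fun i => ⟨fun h => absurd h (Nat.not_lt_zero _), fun _ => rfl⟩
  have h₄ := runs_clearProg n (f n 0 (Mem.init a))
  have e₁ : splitStore (encodeRows n a) (unary 0) [] =
      Function.update (fun _ => []) .inp (encodeRows n a) := by
    funext k
    cases k <;> simp [splitStore, Function.update]
  have e₂ : splitStore [] (unary n) (entries n a).reverse =
      loadStore (unary n) (entries n a).reverse [] := by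
    funext k
    cases k <;> simp [splitStore, loadStore]
  rw [e₁, e₂] at h₁
  obtain ⟨t, ht, h⟩ := h₁.seq (h₂.seq (h₃.seq h₄))
  have hl : (encodeGraph ⟨n, G⟩).length = n * (n + 1) := by rw [hin, encodeRows_length]
  have hn : n ≤ (encodeGraph ⟨n, G⟩).length := by
    rw [hl]
    nlinarith
  have hn' : n * n + n = (encodeGraph ⟨n, G⟩).length := by
    rw [hl]
    ring
  have hT := eval_mono T hn
  have := h.outputs (T := (X * 2 + 1 + (X * 5 + 1 + (T + (X * 10 + 5))) + 1 : ℕ[X]).eval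
    (encodeGraph ⟨n, G⟩).length) ?_
  · rw [hout, ← hin] at this
    have e : ∀ x y : List Sym, x = encodeGraph ⟨n, G⟩ → y = encodePairSet ⟨n, A n G⟩ →
        Nonempty (Turing.TM2OutputsInTime
          (machine (splitProg.seq (loadProg.seq (p.seq clearProg))) Stk.inp Stk.out) x (some y)
          ((X * 2 + 1 + (X * 5 + 1 + (T + (X * 10 + 5))) + 1 : ℕ[X]).eval
            (encodeGraph ⟨n, G⟩).length)) := by
      rintro x y rfl rfl
      exact this
    exact e _ _ (List.map_id _) (List.map_id _)
  · simp only [encodeRows_length, List.length_reverse, entries_length] at ht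
    simp only [eval_add, eval_mul, eval_X, eval_one, eval_ofNat]
    rw [show n * (n + 1) = (encodeGraph ⟨n, G⟩).length from hl.symm] at ht
    lia

/-! ### The greedy algorithm as a command -/

/-- The entry of the matrix `x` at the values of the variables `i` and `j`. -/
def entryAt (x : Fin 4) (i j : Fin 5) (n : ℕ) (env : Fin 5 → ℕ) (M : Mem) : Bool :=
  M.arr x (env i * n + env j)

/-- The loop over the variable `w`. -/
def loop (w : Fin 5) (f : ℕ → (Fin 5 → ℕ) → Mem → Mem) (n : ℕ) (env : Fin 5 → ℕ) (M : Mem) : Mem :=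
  forDown (fun i M => f n (Function.update env w i) M) n M

/-- Fill the identity matrix (number `2`) and the diagonal of matrix `1`. -/
def initCmd : ℕ → (Fin 5 → ℕ) → Mem → Mem :=
  loop 0 fun n env M => (M.set 2 (env 0 * n + env 0) true).set 1 (env 0 * n + env 0) true

/-- Remove the vertices in triangles from the diagonal of matrix `1`. -/
def saturateCmd : ℕ → (Fin 5 → ℕ) → Mem → Mem :=
  loop 0 <| loop 1 <| loop 2 fun n env M =>
    if entryAt 0 0 1 n env M && entryAt 0 0 2 n env M && entryAt 0 1 2 n env M then
      M.set 1 (env 0 * n + env 0) false else M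

/-- Do the pair of variables `1`, `2` have the variable `3` as a common neighbour? -/
def commonNbr (n : ℕ) (env : Fin 5 → ℕ) (M : Mem) : Bool :=
  entryAt 0 1 3 n env M && entryAt 0 2 3 n env M

/-- Is the variable `3` a common neighbour or a member of the pair of variables `1`, `2`? -/
def covers (n : ℕ) (env : Fin 5 → ℕ) (M : Mem) : Bool :=
  commonNbr n env M || (entryAt 2 1 3 n env M || entryAt 2 2 3 n env M)

/-- Choose the pair of variables `1`, `2`. -/
def chooseCmd (n : ℕ) (env : Fin 5 → ℕ) (M : Mem) : Mem :=
  loop 3 (fun n env M => if covers n env M then M.set 1 (env 3 * n + env 3) false else M) n env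
    -- Both orientations are marked because the output is a symmetric matrix.
    ((M.set 3 (env 1 * n + env 2) true).set 3 (env 2 * n + env 1) true)

/-- Choose the pair of variables `1`, `2` if it is at distance two and covers more uncovered
vertices than the value of the variable `0`. -/
def tryCmd (n : ℕ) (env : Fin 5 → ℕ) (M : Mem) : Mem :=
  -- Matrix `2` is the identity, so the first lookup tests whether the two vertices are equal.
  if !entryAt 2 1 2 n env M && !entryAt 0 1 2 n env M then
    -- Variable `4` is never a loop variable and stays `0`: the test asks for at least one common
    -- neighbour.
    if decide (env 4 < (List.range n).countP fun i =>
        commonNbr n (Function.update env 3 i) M) then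
      if decide (env 0 < (List.range n).countP fun i =>
          entryAt 1 3 3 n (Function.update env 3 i) M && covers n (Function.update env 3 i) M) then
        chooseCmd n env M
      else M
    else M
  else M

/-- Write matrix `3` to the output. -/
def emitCmd : ℕ → (Fin 5 → ℕ) → Mem → Mem :=
  -- The output is a stack, so it is written backwards: the loops run downwards and each separator
  -- precedes its row.
  loop 0 fun n env M => loop 1 (fun n env M =>
    { M with out := some (entryAt 3 0 1 n env M) :: M.out }) n env
      { M with out := none :: M.out }

/-- The greedy algorithm: for decreasing thresholds, choose all pairs covering more uncovered
vertices than the threshold. -/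
def greedyCmd (n : ℕ) (env : Fin 5 → ℕ) (M : Mem) : Mem :=
  emitCmd n env (loop 0 (loop 1 (loop 2 tryCmd)) n env (saturateCmd n env (initCmd n env M)))

theorem isExpr_entryAt {d : ℕ} (x : Fin 4) {i j : Fin 5} (hi : i.val < d) (hj : j.val < d) :
    IsExpr d (entryAt x i j) := isExpr_get x hi hj

theorem isCmd_initCmd : IsCmd 0 initCmd :=
  IsCmd.for 0 rfl <| (isCmd_set (d := 1) 2 (i := 0) (j := 0) (by simp) (by simp) true).seq
    (isCmd_set (d := 1) 1 (i := 0) (j := 0) (by simp) (by simp) true)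

theorem isCmd_saturateCmd : IsCmd 0 saturateCmd :=
  IsCmd.for 0 rfl <| IsCmd.for 1 rfl <| IsCmd.for 2 rfl <| IsCmd.ite
    (((isExpr_entryAt 0 (by simp) (by simp)).and (isExpr_entryAt 0 (by simp) (by simp))).and
      (isExpr_entryAt 0 (by simp) (by simp))).isGuard
    (isCmd_set (d := 3) 1 (i := 0) (j := 0) (by simp) (by simp) false)

theorem isExpr_commonNbr : IsExpr 4 commonNbr :=
  (isExpr_entryAt 0 (by simp) (by simp)).and (isExpr_entryAt 0 (by simp) (by simp))

theorem isExpr_covers : IsExpr 4 covers :=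
  isExpr_commonNbr.or ((isExpr_entryAt 2 (by simp) (by simp)).or
    (isExpr_entryAt 2 (by simp) (by simp)))

theorem isCmd_chooseCmd : IsCmd 3 chooseCmd :=
  ((isCmd_set (d := 3) 3 (i := 1) (j := 2) (by simp) (by simp) true).seq
    (isCmd_set (d := 3) 3 (i := 2) (j := 1) (by simp) (by simp) true)).seq
    (IsCmd.for 3 rfl <| IsCmd.ite isExpr_covers.isGuard
      (isCmd_set (d := 4) 1 (i := 3) (j := 3) (by simp) (by simp) false))

theorem isCmd_tryCmd : IsCmd 3 tryCmd :=
  IsCmd.ite ((isExpr_entryAt 2 (i := 1) (j := 2) (by simp) (by simp)).not.and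
    (isExpr_entryAt 0 (i := 1) (j := 2) (by simp) (by simp)).not).isGuard <|
    IsCmd.ite (isExpr_commonNbr.count 4 3 rfl) <|
      IsCmd.ite (((isExpr_entryAt 1 (i := 3) (j := 3) (by simp) (by simp)).and
        isExpr_covers).count 0 3 rfl) isCmd_chooseCmd

theorem isCmd_emitCmd : IsCmd 0 emitCmd :=
  IsCmd.for 0 rfl <| (isCmd_emit_sep 1).seq <| IsCmd.for 1 rfl
    (isExpr_entryAt (d := 2) 3 (i := 0) (j := 1) (by simp) (by simp)).emit

theorem isCmd_greedyCmd : IsCmd 0 greedyCmd :=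
  ((isCmd_initCmd.seq isCmd_saturateCmd).seq
    (IsCmd.for 0 rfl <| IsCmd.for 1 rfl <| IsCmd.for 2 rfl isCmd_tryCmd)).seq isCmd_emitCmd

/-! ### What the commands do to the represented graph data -/

theorem index_inj {n i j i' j' : ℕ} (hj : j < n) (hj' : j' < n) :
    i * n + j = i' * n + j' ↔ i = i' ∧ j = j' := by
  refine ⟨fun h => ?_, fun h => by rw [h.1, h.2]⟩
  have h₁ : (j + n * i) / n = (j' + n * i') / n := by
    rw [mul_comm n, mul_comm n, add_comm j, add_comm j', h]
  rw [Nat.add_mul_div_left _ _ (by lia), Nat.add_mul_div_left _ _ (by lia),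
    Nat.div_eq_of_lt hj, Nat.div_eq_of_lt hj', zero_add, zero_add] at h₁
  subst h₁
  exact ⟨rfl, by lia⟩

theorem Mem.set_arr {n : ℕ} (M : Mem) (x y : Fin 4) (i j i' j' : Fin n) (b : Bool) :
    (M.set x (i * n + j) b).arr y (i' * n + j') =
      if y = x ∧ i' = i ∧ j' = j then b else M.arr y (i' * n + j') := by
  by_cases hy : y = x
  · subst hy
    by_cases h : i' = i ∧ j' = j
    · simp [Mem.set, h]
    · have h' : ¬ ((i' : ℕ) * n + j' = i * n + j) := by
        rw [index_inj j'.2 j.2, Fin.val_inj, Fin.val_inj]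
        exact h
      rw [if_neg (by tauto)]
      simp [Mem.set, Function.update_of_ne h']
  · simp [Mem.set, hy]

/-- The memory represents the graph `G`, the set `R` of uncovered vertices, and the relations
`E` and `S` in the matrices `2` and `3`. -/
structure Represents {n : ℕ} (G : SimpleGraph (Fin n)) (R : Set (Fin n))
    (E S : Fin n → Fin n → Prop) (M : Mem) : Prop where
  adj : ∀ i j : Fin n, M.arr 0 (i * n + j) = true ↔ G.Adj i j
  uncovered : ∀ i : Fin n, M.arr 1 (i * n + i) = true ↔ i ∈ R
  ident : ∀ i j : Fin n, M.arr 2 (i * n + j) = true ↔ E i j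
  chosen : ∀ i j : Fin n, M.arr 3 (i * n + j) = true ↔ S i j
  out : M.out = []

section Represents

variable {n : ℕ} {G : SimpleGraph (Fin n)} {R : Set (Fin n)} {E S : Fin n → Fin n → Prop}
  {M : Mem}

theorem Represents.congr {R' : Set (Fin n)} {E' S' : Fin n → Fin n → Prop}
    (h : Represents G R E S M) (hR : ∀ i, i ∈ R ↔ i ∈ R') (hE : ∀ i j, E i j ↔ E' i j)
    (hS : ∀ i j, S i j ↔ S' i j) : Represents G R' E' S' M :=
  ⟨h.adj, fun i => (h.uncovered i).trans (hR i), fun i j => (h.ident i j).trans (hE i j),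
    fun i j => (h.chosen i j).trans (hS i j), h.out⟩

theorem Represents.insert (h : Represents G R E S M) (w : Fin n) :
    Represents G (insert w R) E S (M.set 1 (w * n + w) true) := by
  refine ⟨fun i j => ?_, fun i => ?_, fun i j => ?_, fun i j => ?_, h.out⟩ <;>
    rw [Mem.set_arr]
  · simpa using h.adj i j
  · by_cases hi : i = w <;> simp [hi, h.uncovered]
  · simpa using h.ident i j
  · simpa using h.chosen i j

theorem Represents.erase (h : Represents G R E S M) (w : Fin n) :
    Represents G (R \ {w}) E S (M.set 1 (w * n + w) false) := by
  refine ⟨fun i j => ?_, fun i => ?_, fun i j => ?_, fun i j => ?_, h.out⟩ <;>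
    rw [Mem.set_arr]
  · simpa using h.adj i j
  · by_cases hi : i = w <;> simp [hi, h.uncovered]
  · simpa using h.ident i j
  · simpa using h.chosen i j

theorem Represents.setIdent (h : Represents G R E S M) (u v : Fin n) :
    Represents G R (fun i j => (i = u ∧ j = v) ∨ E i j) S (M.set 2 (u * n + v) true) := by
  refine ⟨fun i j => ?_, fun i => ?_, fun i j => ?_, fun i j => ?_, h.out⟩ <;>
    rw [Mem.set_arr]
  · simpa using h.adj i j
  · simpa using h.uncovered i
  · by_cases hi : i = u ∧ j = v <;> simp [hi, h.ident]
  · simpa using h.chosen i j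

theorem Represents.choose (h : Represents G R E S M) (u v : Fin n) :
    Represents G R E (fun i j => (i = u ∧ j = v) ∨ S i j) (M.set 3 (u * n + v) true) := by
  refine ⟨fun i j => ?_, fun i => ?_, fun i j => ?_, fun i j => ?_, h.out⟩ <;>
    rw [Mem.set_arr]
  · simpa using h.adj i j
  · simpa using h.uncovered i
  · simpa using h.ident i j
  · by_cases hi : i = u ∧ j = v <;> simp [hi, h.chosen]

/-- The set removed in round `i` does not depend on the current `R`, so a loop removes the union.
Nested loops are handled by repeated use. -/
theorem Represents.forDown_erase {g : ℕ → Mem → Mem} {bad : Fin n → Set (Fin n)}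
    (hg : ∀ (i : Fin n) R M, Represents G R E S M → Represents G (R \ bad i) E S (g i M))
    (h : Represents G R E S M) :
    Represents G (R \ ⋃ i, bad i) E S (forDown g n M) := by
  have := forDown_induction (g := g) (n := n) (a := M)
    (fun k M => Represents G (R \ ⋃ i : {i : Fin n // k ≤ i.val}, bad i) E S M) ?_ ?_
  · refine this.congr (fun i => ?_) (fun _ _ => Iff.rfl) fun _ _ => Iff.rfl
    simp
  · refine h.congr (fun i => ?_) (fun _ _ => Iff.rfl) fun _ _ => Iff.rfl
    have : ∀ x : Fin n, ¬ n ≤ x.val := fun x => x.2.not_ge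
    simp [this]
  · intro k hk M hM
    refine (hg ⟨k, hk⟩ _ M hM).congr (fun i => ?_) (fun _ _ => Iff.rfl) fun _ _ => Iff.rfl
    simp only [Set.mem_sdiff, Set.mem_iUnion, Subtype.exists, exists_prop, not_exists, not_and,
      and_assoc]
    refine and_congr_right fun _ => ⟨fun ⟨h₁, h₂⟩ x hx => ?_, fun h => ⟨fun x hx => h x (by lia),
      h _ le_rfl⟩⟩
    rcases Nat.eq_or_lt_of_le hx with e | e
    · have : x = ⟨k, hk⟩ := Fin.ext e.symm
      exact this ▸ h₂
    · exact h₁ x e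

theorem represents_initCmd {a : ℕ → Bool} (ha : ∀ i j : Fin n, a (i * n + j) = true ↔ G.Adj i j)
    (env : Fin 5 → ℕ) :
    Represents G Set.univ (· = ·) (fun _ _ => False) (initCmd n env (Mem.init a)) := by
  have := forDown_induction (n := n) (a := Mem.init a)
    (g := fun i M => (M.set 2 (i * n + i) true).set 1 (i * n + i) true)
    (fun k M => Represents G {i | k ≤ i.val} (fun i j => i = j ∧ k ≤ i.val) (fun _ _ => False) M)
    ?_ ?_
  · refine Represents.congr (M := initCmd n env (Mem.init a)) (R := {i | 0 ≤ i.val})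
      (E := fun i j => i = j ∧ 0 ≤ i.val) (S := fun _ _ => False) ?_ ?_ ?_ fun _ _ => Iff.rfl
    · simpa [initCmd, loop] using this
    · simp
    · simp
  · have : ∀ x : Fin n, ¬ n ≤ x.val := fun x => x.2.not_ge
    exact ⟨fun i j => by simpa [Mem.init] using ha i j, fun i => by simp [Mem.init],
      fun i j => by simp [Mem.init], fun i j => by simp [Mem.init], rfl⟩
  · intro k hk M hM
    refine ((hM.setIdent ⟨k, hk⟩ ⟨k, hk⟩).insert ⟨k, hk⟩).congr (fun i => ?_) (fun i j => ?_)
      fun _ _ => Iff.rfl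
    · simp only [Set.mem_insert_iff, Set.mem_ofPred_eq, Fin.ext_iff]
      lia
    · simp only [Fin.ext_iff]
      lia

theorem represents_saturateCmd (h : Represents G Set.univ E S M) (env : Fin 5 → ℕ) :
    Represents G (unsaturated G) E S (saturateCmd n env M) := by
  have := h.forDown_erase (g := fun w M => forDown (fun u M => forDown (fun v M =>
      if M.arr 0 (w * n + u) && M.arr 0 (w * n + v) && M.arr 0 (u * n + v) then
        M.set 1 (w * n + w) false else M) n M) n M)
    (bad := fun w => ⋃ u, ⋃ v, {i | i = w ∧ G.Adj w u ∧ G.Adj w v ∧ G.Adj u v}) ?_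
  · refine Represents.congr (M := saturateCmd n env M) (R := Set.univ \ ⋃ w, ⋃ u, ⋃ v,
      {i | i = w ∧ G.Adj w u ∧ G.Adj w v ∧ G.Adj u v}) (E := E) (S := S) ?_ ?_
      (fun _ _ => Iff.rfl) fun _ _ => Iff.rfl
    · simpa [saturateCmd, loop, entryAt] using this
    · intro i
      simp [unsaturated, InTriangle]
  · intro w R M h
    refine h.forDown_erase fun u R M h => h.forDown_erase fun v R M h => ?_
    by_cases hb : G.Adj w u ∧ G.Adj w v ∧ G.Adj u v
    · rw [if_pos (by simpa [h.adj, and_assoc] using hb)]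
      refine (h.erase w).congr (fun i => ?_) (fun _ _ => Iff.rfl) fun _ _ => Iff.rfl
      simp [hb]
    · rw [if_neg (by simpa [h.adj, and_assoc] using hb)]
      refine h.congr (fun i => ?_) (fun _ _ => Iff.rfl) fun _ _ => Iff.rfl
      simp [hb]

end Represents

theorem forDown_emit (m : ℕ) (b : (Fin 4 → ℕ → Bool) → ℕ → Bool) (M : Mem) :
    forDown (fun j (M : Mem) => { M with out := some (b M.arr j) :: M.out }) m M =
      { M with out := (List.range m).map (fun j => some (b M.arr j)) ++ M.out } := by
  induction m generalizing M with
  | zero => rfl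
  | succ m ih => simp [forDown, ih, List.range_succ]

theorem emitCmd_out (n : ℕ) (env : Fin 5 → ℕ) (M : Mem) (hM : M.out = []) :
    (emitCmd n env M).out = encodeRows n (M.arr 3) := by
  have key : ∀ (m : ℕ) (M : Mem), forDown (fun i (M : Mem) => forDown (fun j (M : Mem) =>
      { M with out := some (M.arr 3 (i * n + j)) :: M.out }) n { M with out := none :: M.out }) m M
      = { M with out := ((List.range m).flatMap fun i =>
          (List.range n).map (fun j => some (M.arr 3 (i * n + j))) ++ [none]) ++ M.out } := by
    intro m
    induction m with
    | zero => exact fun M => rfl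
    | succ m ih =>
      intro M
      have e := forDown_emit n (fun a j => a 3 (m * n + j)) { M with out := none :: M.out }
      rw [forDown, e, ih]
      simp [List.range_succ]
  have e : emitCmd n env M = _ := key n M
  rw [e]
  simp [hM, encodeRows]

/-- This form of distance two can be tested on the adjacency matrix, and it is exactly what `tryCmd`
tests. -/
theorem dist_eq_two_iff {V : Type*} {G : SimpleGraph V} {u v : V} :
    G.dist u v = 2 ↔ u ≠ v ∧ ¬ G.Adj u v ∧ ∃ w, G.Adj u w ∧ G.Adj v w := by
  constructor
  · intro h
    refine ⟨fun e => ?_, fun e => ?_, ?_⟩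
    · subst e
      simp at h
    · rw [SimpleGraph.dist_eq_one_iff_adj.2 e] at h
      simp at h
    · have hr : G.Reachable u v := SimpleGraph.Reachable.of_dist_ne_zero (by rw [h]; simp)
      obtain ⟨p, hp⟩ := hr.exists_walk_length_eq_dist
      rw [h] at hp
      cases p with
      | nil => simp at hp
      | cons h₁ q =>
        cases q with
        | nil => simp at hp
        | cons h₂ r =>
          cases r with
          | nil => exact ⟨_, h₁, h₂.symm⟩
          | cons h₃ s => simp at hp
  · rintro ⟨h₁, h₂, w, h₃, h₄⟩
    have hle : G.dist u v ≤ 2 :=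
      SimpleGraph.dist_le (SimpleGraph.Walk.cons h₃ (SimpleGraph.Walk.cons h₄.symm .nil))
    have hr : G.Reachable u v := h₃.reachable.trans h₄.symm.reachable
    have h₀ : G.dist u v ≠ 0 := fun e => h₁ (hr.dist_eq_zero_iff.1 e)
    have h₁' : G.dist u v ≠ 1 := fun e => h₂ (SimpleGraph.dist_eq_one_iff_adj.1 e)
    lia

theorem countP_range_eq_ncard (n : ℕ) (q : ℕ → Bool) :
    (List.range n).countP q = {i : Fin n | q i = true}.ncard := by
  rw [← List.map_coe_finRange_eq_range, List.countP_map, List.countP_eq_length_filter,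
    ← List.toFinset_card_of_nodup ((List.nodup_finRange n).filter _), ← Set.ncard_coe_finset]
  congr 1
  ext i
  simp

/-! ### The invariant of the greedy loops -/

section

variable {n : ℕ} {G : SimpleGraph (Fin n)}

/-- The memory is a state of the greedy algorithm, reached by a prefix of a greedy run, and the
set of uncovered vertices satisfies `c`. -/
def GreedyState (G : SimpleGraph (Fin n)) (c : Set (Fin n) → Prop) (M : Mem) : Prop :=
  ∃ (R : Set (Fin n)) (L : List (Fin n × Fin n)),
    Represents G R (· = ·) (fun i j => s(i, j) ∈ L.map fun p => s(p.1, p.2)) M ∧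
    (∀ L', GreedyRun G R L' → GreedyRun G (unsaturated G) (L ++ L')) ∧
    R ⊆ unsaturated G ∧ c R

/-- Explains why `covers` need not test for unsaturated vertices: it is only used to count in, or
remove from, a set `R` of such vertices. -/
theorem mem_coverSet_of_subset {R : Set (Fin n)} (hR : R ⊆ unsaturated G) {u v i : Fin n}
    (hi : i ∈ R) :
    i ∈ coverSet G u v ↔ (G.Adj u i ∧ G.Adj v i) ∨ u = i ∨ v = i := by
  have := hR hi
  simp [coverSet, this, eq_comm]

/-- As no pair covers more than `t + 1`, one covering more than `t` is a legal greedy choice, and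
afterwards it covers nothing. The condition `c` collects what is known of pairs already treated; it
survives because `R` only shrinks. -/
theorem greedyState_tryCmd {c : Set (Fin n) → Prop} (hc : ∀ R R', R' ⊆ R → c R → c R') {t : ℕ}
    (hct : ∀ R, c R → ∀ x y, G.dist x y = 2 → (R ∩ coverSet G x y).ncard ≤ t + 1)
    {env : Fin 5 → ℕ} (h₀ : env 0 = t) (h₄ : env 4 = 0) {u v : Fin n} (h₁ : env 1 = u)
    (h₂ : env 2 = v) {M : Mem} (hM : GreedyState G c M) :
    GreedyState G (fun R => c R ∧ (G.dist u v = 2 → (R ∩ coverSet G u v).ncard ≤ t))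
      (tryCmd n env M) := by
  obtain ⟨R, L, hr, hL, hRU, hcR⟩ := hM
  have hE₁ : (!entryAt 2 1 2 n env M && !entryAt 0 1 2 n env M) = true ↔
      u ≠ v ∧ ¬ G.Adj u v := by
    have a₁ := hr.ident u v
    have a₂ := hr.adj u v
    simp only [entryAt, h₁, h₂, Bool.and_eq_true, Bool.not_eq_true', ← Bool.not_eq_true, a₁, a₂,
      ne_eq]
  have hE₂ : decide (env 4 < (List.range n).countP fun i =>
      commonNbr n (Function.update env 3 i) M) = true ↔ ∃ w, G.Adj u w ∧ G.Adj v w := by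
    rw [countP_range_eq_ncard, h₄, decide_eq_true_iff, Set.ncard_pos]
    refine exists_congr fun w => ?_
    simp [commonNbr, entryAt, h₁, h₂, hr.adj]
  have hE₃ : decide (env 0 < (List.range n).countP fun i =>
      entryAt 1 3 3 n (Function.update env 3 i) M && covers n (Function.update env 3 i) M) = true ↔
      t < (R ∩ coverSet G u v).ncard := by
    rw [countP_range_eq_ncard, h₀, decide_eq_true_iff]
    congr! 2
    ext w
    simp only [covers, commonNbr, entryAt, Set.mem_ofPred_eq, Function.update_self,
      Function.update_of_ne (show (1 : Fin 5) ≠ 3 by decide),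
      Function.update_of_ne (show (2 : Fin 5) ≠ 3 by decide), h₁, h₂, Bool.and_eq_true,
      Bool.or_eq_true, hr.adj, hr.ident, hr.uncovered, Set.mem_inter_iff]
    exact and_congr_right fun hw => (mem_coverSet_of_subset hRU hw).symm
  have stay : (G.dist u v = 2 → (R ∩ coverSet G u v).ncard ≤ t) →
      GreedyState G (fun R => c R ∧ (G.dist u v = 2 → (R ∩ coverSet G u v).ncard ≤ t)) M :=
    fun h => ⟨R, L, hr, hL, hRU, hcR, h⟩
  rw [tryCmd]
  split_ifs with c₁ c₂ c₃
  · rw [hE₁] at c₁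
    rw [hE₂] at c₂
    rw [hE₃] at c₃
    have hd : G.dist u v = 2 := dist_eq_two_iff.2 ⟨c₁.1, c₁.2, c₂⟩
    have hsub : R \ coverSet G u v ⊆ R := Set.sdiff_subset
    refine ⟨R \ coverSet G u v, L ++ [(u, v)], ?_, fun L' hL' => ?_, hsub.trans hRU,
      hc _ _ hsub hcR, fun _ => ?_⟩
    · have := ((hr.choose u v).choose v u).forDown_erase (g := fun i M =>
        if (M.arr 0 (u * n + i) && M.arr 0 (v * n + i) ||
          (M.arr 2 (u * n + i) || M.arr 2 (v * n + i))) then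
          M.set 1 (i * n + i) false else M)
        (bad := fun i => {j | j = i ∧ ((G.Adj u i ∧ G.Adj v i) ∨ u = i ∨ v = i)}) ?_
      · refine Represents.congr (M := chooseCmd n env M) (R := R \ ⋃ i, {j | j = i ∧
          ((G.Adj u i ∧ G.Adj v i) ∨ u = i ∨ v = i)}) (E := (· = ·)) (S := fun i j =>
          (i = v ∧ j = u) ∨ (i = u ∧ j = v) ∨ s(i, j) ∈ L.map fun p => s(p.1, p.2))
          ?_ ?_ (fun _ _ => Iff.rfl) ?_
        · simpa [chooseCmd, loop, covers, commonNbr, entryAt, h₁, h₂] using this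
        · intro i
          simp only [Set.mem_sdiff, Set.mem_iUnion, Set.mem_ofPred_eq, exists_eq_left']
          exact and_congr_right fun hi => not_congr (mem_coverSet_of_subset hRU hi).symm
        · intro i j
          simp only [List.map_append, List.mem_append, List.map_cons, List.map_nil,
            List.mem_singleton, Sym2.eq_iff]
          tauto
      · intro i R M h
        by_cases hb : (G.Adj u i ∧ G.Adj v i) ∨ u = i ∨ v = i
        · rw [if_pos (by simpa [h.adj, h.ident] using hb)]
          refine (h.erase i).congr (fun j => ?_) (fun _ _ => Iff.rfl) fun _ _ => Iff.rfl
          simp [hb]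
        · rw [if_neg (by simpa [h.adj, h.ident] using hb)]
          refine h.congr (fun j => ?_) (fun _ _ => Iff.rfl) fun _ _ => Iff.rfl
          simp [hb]
    · rw [List.append_assoc]
      -- As `t < m` means `t + 1 ≤ m`, `c₃` closes the gap between the upper bound and the chosen
      -- pair.
      refine hL _ (GreedyRun.step hd ?_ (fun x y hxy => (hct R hcR x y hxy).trans c₃) hL')
      rw [← Set.ncard_pos]
      lia
    · have : (R \ coverSet G u v) ∩ coverSet G u v = ∅ := Set.sdiff_inter_self
      simp [this]
  · rw [hE₃] at c₃
    exact stay fun _ => not_lt.1 c₃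
  · rw [hE₂] at c₂
    exact stay fun h => absurd (dist_eq_two_iff.1 h).2.2 c₂
  · rw [hE₁] at c₁
    exact stay fun h => absurd ⟨(dist_eq_two_iff.1 h).1, (dist_eq_two_iff.1 h).2.1⟩ c₁

theorem GreedyState.imp {c c' : Set (Fin n) → Prop} {M : Mem} (h : GreedyState G c M)
    (hc : ∀ R, c R → c' R) : GreedyState G c' M :=
  let ⟨R, L, h₁, h₂, h₃, h₄⟩ := h
  ⟨R, L, h₁, h₂, h₃, hc R h₄⟩

/-- Every pair at distance two covers at most `t` elements of `R`. -/
def CoversAtMost (G : SimpleGraph (Fin n)) (t : ℕ) (R : Set (Fin n)) : Prop :=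
  ∀ x y, G.dist x y = 2 → (R ∩ coverSet G x y).ncard ≤ t

/-- The bound `n` holds at the start by the number of vertices, and the sweep at threshold `t`
improves `t + 1` to `t`. -/
theorem greedyState_main {env : Fin 5 → ℕ} (h₄ : env 4 = 0) {M : Mem}
    (hM : GreedyState G (fun _ => True) M) :
    GreedyState G (CoversAtMost G 0) (loop 0 (loop 1 (loop 2 tryCmd)) n env M) := by
  have mono : ∀ {R R' : Set (Fin n)} {x y : Fin n} {t : ℕ}, R' ⊆ R →
      (R ∩ coverSet G x y).ncard ≤ t → (R' ∩ coverSet G x y).ncard ≤ t := fun h h' =>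
    (Set.ncard_le_ncard (Set.inter_subset_inter_left _ h)).trans h'
  refine forDown_induction (fun t M => GreedyState G (CoversAtMost G t) M) ?_ ?_
  · refine hM.imp fun R _ x y _ => ?_
    simpa using Set.ncard_le_card (R ∩ coverSet G x y)
  · intro t _ M hM
    -- Loops run downwards: rows with index at least `k` are finished and already satisfy the bound
    -- `t`.
    have := forDown_induction (n := n) (a := M)
      (g := fun u M => loop 2 tryCmd n (Function.update (Function.update env 0 t) 1 u) M)
      (fun k M => GreedyState G (fun R => CoversAtMost G (t + 1) R ∧
        ∀ u : Fin n, k ≤ u.val → ∀ v, G.dist u v = 2 → (R ∩ coverSet G u v).ncard ≤ t) M) ?_ ?_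
    · exact this.imp fun R hR u v => hR.2 u (Nat.zero_le _) v
    · exact hM.imp fun R hR => ⟨hR, fun u hu => absurd u.2 hu.not_gt⟩
    · intro u hu M hM
      have := forDown_induction (n := n) (a := M) (g := fun v M => tryCmd n (Function.update
          (Function.update (Function.update env 0 t) 1 u) 2 v) M)
        (fun k M => GreedyState G (fun R => (CoversAtMost G (t + 1) R ∧
          ∀ x : Fin n, u + 1 ≤ x.val → ∀ v, G.dist x v = 2 → (R ∩ coverSet G x v).ncard ≤ t) ∧
          ∀ v : Fin n, k ≤ v.val → G.dist ⟨u, hu⟩ v = 2 →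
            (R ∩ coverSet G ⟨u, hu⟩ v).ncard ≤ t) M) ?_ ?_
      · refine this.imp fun R hR => ⟨hR.1.1, fun x hx v hv => ?_⟩
        rcases Nat.eq_or_lt_of_le hx with e | e
        · have : x = ⟨u, hu⟩ := Fin.ext e.symm
          subst this
          exact hR.2 v (Nat.zero_le _) hv
        · exact hR.1.2 x e v hv
      · exact hM.imp fun R hR => ⟨hR, fun v hv => absurd v.2 hv.not_gt⟩
      · intro v hv M hM
        refine (greedyState_tryCmd (u := ⟨u, hu⟩) (v := ⟨v, hv⟩) (t := t) ?_ ?_ ?_ ?_ ?_ ?_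
          hM).imp ?_
        · exact fun R R' hR h => ⟨⟨fun x y hxy => mono hR (h.1.1 x y hxy),
            fun x hx y hxy => mono hR (h.1.2 x hx y hxy)⟩, fun y hy hxy => mono hR (h.2 y hy hxy)⟩
        · exact fun R hR => hR.1.1
        · simp
        · simpa using h₄
        · simp
        · simp
        · refine fun R hR => ⟨hR.1.1, fun x hx hd => ?_⟩
          rcases Nat.eq_or_lt_of_le hx with e | e
          · have : x = ⟨v, hv⟩ := Fin.ext e.symm
            subst this
            exact hR.2 hd
          · exact hR.1.2 x e hd

end

/-- Without an assumption on the components some vertices may lie in no set. So `L` is only a prefix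
of a run, and no pair covers any vertex of the remainder `R`. -/
theorem exists_greedyCmd (n : ℕ) (G : SimpleGraph (Fin n)) :
    ∃ (a : ℕ → Bool) (L : List (Fin n × Fin n)) (R : Set (Fin n)),
      (∀ i j : Fin n, a (i * n + j) = true ↔ G.Adj i j) ∧
      (greedyCmd n 0 (Mem.init a)).out =
        encodePairSet ⟨n, (L.map fun p => s(p.1, p.2)).toFinset⟩ ∧
      (∀ L', GreedyRun G R L' → GreedyRun G (unsaturated G) (L ++ L')) ∧
      R ⊆ unsaturated G ∧ CoversAtMost G 0 R := by
  classical
  let a : ℕ → Bool := fun p => decide (∃ i j : Fin n, p = i * n + j ∧ G.Adj i j)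
  have ha : ∀ i j : Fin n, a (i * n + j) = true ↔ G.Adj i j := by
    intro i j
    simp only [a, decide_eq_true_iff]
    refine ⟨fun ⟨i', j', h, hadj⟩ => ?_, fun h => ⟨i, j, rfl, h⟩⟩
    rw [index_inj j.2 j'.2, Fin.val_inj, Fin.val_inj] at h
    rw [h.1, h.2]
    exact hadj
  have h₁ := represents_saturateCmd (represents_initCmd ha 0) 0
  obtain ⟨R, L, hr, hL, hRU, hc⟩ := greedyState_main (env := 0) rfl (G := G)
    (M := saturateCmd n 0 (initCmd n 0 (Mem.init a)))
    ⟨_, [], h₁.congr (fun _ => Iff.rfl) (fun _ _ => Iff.rfl) (by simp), fun _ h => h,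
      subset_rfl, trivial⟩
  refine ⟨a, L, R, ha, ?_, hL, hRU, hc⟩
  rw [greedyCmd, emitCmd_out _ _ _ hr.out]
  symm
  refine encodeRel_eq_encodeRows fun i j => ?_
  rw [hr.chosen, List.mem_toFinset]

/-! ### Completion sets versus covers by pairs at distance two -/

section Cover

variable {V : Type*} {G : SimpleGraph V}

theorem coverSet_comm (u v : V) : coverSet G u v = coverSet G v u := by
  ext w
  simp only [coverSet, Set.mem_union, Set.mem_ofPred_eq, Set.pair_comm u v,
    and_comm (a := G.Adj u w)]

theorem left_mem_coverSet {u : V} (hu : u ∈ unsaturated G) (v : V) : u ∈ coverSet G u v :=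
  Or.inr ⟨Or.inl rfl, hu⟩

theorem right_mem_coverSet (u : V) {v : V} (hv : v ∈ unsaturated G) : v ∈ coverSet G u v :=
  Or.inr ⟨Or.inr rfl, hv⟩

/-- The pairs in `F` are at distance two, and their sets cover the unsaturated vertices. -/
def IsDistTwoCover (G : SimpleGraph V) (F : Finset (Sym2 V)) : Prop :=
  (∀ u v, s(u, v) ∈ F → G.dist u v = 2) ∧
    ∀ w ∈ unsaturated G, ∃ u v, s(u, v) ∈ F ∧ w ∈ coverSet G u v

/-- The new edge `uv` closes a triangle with every common neighbour. A covered common neighbour is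
itself the third vertex; a covered end uses any common neighbour. -/
theorem IsDistTwoCover.isCompletionSet {F : Finset (Sym2 V)} (h : IsDistTwoCover G F) :
    IsCompletionSet G F := by
  refine ⟨fun e he => ?_, fun w => ?_⟩
  · induction e with
    | _ u v =>
      obtain ⟨h₁, h₂, -⟩ := dist_eq_two_iff.1 (h.1 u v he)
      exact ⟨by simpa using h₁, by simpa using h₂⟩
  · by_cases hw : InTriangle G w
    · obtain ⟨u, v, h₁, h₂, h₃⟩ := hw
      exact ⟨u, v, Or.inl h₁, Or.inl h₂, Or.inl h₃⟩
    · obtain ⟨u, v, hF, hc⟩ := h.2 w hw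
      obtain ⟨hne, -, z, hu, hv⟩ := dist_eq_two_iff.1 (h.1 u v hF)
      have hF' : (SimpleGraph.fromEdgeSet (F : Set (Sym2 V))).Adj u v := by
        simpa [hne] using hF
      rcases hc with ⟨-, h₁, h₂⟩ | ⟨rfl | rfl, -⟩
      · exact ⟨u, v, Or.inl h₁.symm, Or.inl h₂.symm, Or.inr hF'⟩
      · exact ⟨v, z, Or.inr hF', Or.inl hu, Or.inl hv⟩
      · exact ⟨u, z, Or.inr hF'.symm, Or.inl hv, Or.inl hu⟩

/-- Otherwise no edge leaves `{w, y}`, and the component of `w` has at most two vertices. The case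
`y = w` yields a neighbour of `w`. -/
theorem exists_adj_not_mem_pair (hG : ∀ c : G.ConnectedComponent, 3 ≤ c.supp.ncard) (w y : V) :
    ∃ z, z ≠ w ∧ z ≠ y ∧ (G.Adj w z ∨ G.Adj y z) := by
  by_contra! h
  have hsub : (G.connectedComponentMk w).supp ⊆ {w, y} := by
    intro z hz
    have hr : G.Reachable w z := (SimpleGraph.ConnectedComponent.exact hz).symm
    rw [SimpleGraph.reachable_iff_reflTransGen] at hr
    induction hr with
    | refl => exact Or.inl rfl
    | @tail a b hr hab ih =>
      have ha := ih (SimpleGraph.ConnectedComponent.sound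
        ((SimpleGraph.reachable_iff_reflTransGen _ _).2 hr).symm)
      by_contra hb
      simp only [Set.mem_insert_iff, Set.mem_singleton_iff, not_or] at hb
      rcases ha with rfl | rfl
      · exact (h b hb.1 hb.2).1 hab
      · exact (h b hb.1 hb.2).2 hab
  have h₁ := Set.ncard_le_ncard hsub (Set.toFinite _)
  have h₂ := (Set.ncard_insert_le w {y}).trans_eq (by rw [Set.ncard_singleton])
  have h₃ := hG (G.connectedComponentMk w)
  lia

/-- If a third vertex `z` is adjacent to `w`, it is not adjacent to `y` because `w` is unsaturated.
Then the pair `zy` has `w` as a common neighbour and `y` as an end; the other case is symmetric. -/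
theorem exists_coverSet_pair (hG : ∀ c : G.ConnectedComponent, 3 ≤ c.supp.ncard) {w y : V}
    (hw : w ∈ unsaturated G) (hy : y ∈ unsaturated G) (h : G.Adj w y) :
    ∃ u v, G.dist u v = 2 ∧ w ∈ coverSet G u v ∧ y ∈ coverSet G u v := by
  obtain ⟨z, hzw, hzy, hz | hz⟩ := exists_adj_not_mem_pair hG w y
  · refine ⟨z, y, dist_eq_two_iff.2 ⟨hzy, fun e => hw ⟨z, y, hz, h, e⟩, w, hz.symm, h.symm⟩,
      Or.inl ⟨hw, hz.symm, h.symm⟩, right_mem_coverSet _ hy⟩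
  · refine ⟨z, w, dist_eq_two_iff.2 ⟨hzw, fun e => hy ⟨z, w, hz, h.symm, e⟩, y, hz.symm, h⟩,
      right_mem_coverSet _ hw, Or.inl ⟨hy, hz.symm, h⟩⟩

theorem exists_mem_coverSet (hG : ∀ c : G.ConnectedComponent, 3 ≤ c.supp.ncard) {w : V}
    (hw : w ∈ unsaturated G) : ∃ u v, G.dist u v = 2 ∧ w ∈ coverSet G u v := by
  obtain ⟨y, hyw, -, h⟩ := exists_adj_not_mem_pair hG w w
  rw [or_self] at h
  obtain ⟨z, hzw, hzy, hz | hz⟩ := exists_adj_not_mem_pair hG w y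
  · exact ⟨y, z, dist_eq_two_iff.2 ⟨hzy.symm, fun e => hw ⟨y, z, h, hz, e⟩, w, h.symm, hz.symm⟩,
      Or.inl ⟨hw, h.symm, hz.symm⟩⟩
  · by_cases e : G.Adj z w
    · exact absurd ⟨y, z, h, e.symm, hz⟩ hw
    · exact ⟨z, w, dist_eq_two_iff.2 ⟨hzw, e, y, hz.symm, h⟩, right_mem_coverSet _ hw⟩

/-- The vertices can be assigned distinct edges, apart from the roots of the components that lie
in no triangle. -/
theorem exists_injOn_edgeSet [Finite V] (H : SimpleGraph V) (root : H.ConnectedComponent → V)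
    (hroot : ∀ C, H.connectedComponentMk (root C) = C) :
    ∃ f : V → Sym2 V,
      Set.InjOn f {v | v ≠ root (H.connectedComponentMk v) ∨ InTriangle H v} ∧
      ∀ v, v ≠ root (H.connectedComponentMk v) ∨ InTriangle H v → f v ∈ H.edgeSet := by
  -- A vertex that is not a root takes an edge to a neighbour closer to the root; this edge joins
  -- consecutive levels and its farther end is the vertex. A root in a triangle takes the opposite
  -- edge, which lies within level one and determines the component. So no edge is taken twice.
  let d : V → ℕ := fun v => H.dist (root (H.connectedComponentMk v)) v
  have key : ∀ v, ∃ e : Sym2 V, v ≠ root (H.connectedComponentMk v) ∨ InTriangle H v →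
      e ∈ H.edgeSet ∧ ((∃ u, e = s(v, u) ∧ d u + 1 = d v) ∨
        (v = root (H.connectedComponentMk v) ∧ ∃ x y, e = s(x, y) ∧ d x = 1 ∧ d y = 1 ∧
          H.connectedComponentMk x = H.connectedComponentMk v ∧
          H.connectedComponentMk y = H.connectedComponentMk v)) := by
    intro v
    by_cases hv : v = root (H.connectedComponentMk v)
    · by_cases ht : InTriangle H v
      · obtain ⟨x, y, hx, hy, hxy⟩ := ht
        have hd : ∀ x, H.Adj v x →
            d x = 1 ∧ H.connectedComponentMk x = H.connectedComponentMk v := by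
          intro x hx
          have e := SimpleGraph.ConnectedComponent.sound hx.symm.reachable
          refine ⟨?_, e⟩
          change H.dist (root (H.connectedComponentMk x)) x = 1
          rw [e, ← hv, SimpleGraph.dist_eq_one_iff_adj]
          exact hx
        exact ⟨s(x, y), fun _ => ⟨hxy, Or.inr ⟨hv, x, y, rfl, (hd x hx).1, (hd y hy).1,
          (hd x hx).2, (hd y hy).2⟩⟩⟩
      · exact ⟨s(v, v), fun h => absurd h (by tauto)⟩
    · have hr : H.Reachable v (root (H.connectedComponentMk v)) :=
        (SimpleGraph.ConnectedComponent.exact (hroot _)).symm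
      obtain ⟨p, hp⟩ := hr.exists_walk_length_eq_dist
      generalize hρ : root (H.connectedComponentMk v) = ρ at hv p hp
      cases p with
      | nil => exact absurd rfl hv
      | @cons _ u _ h q =>
        refine ⟨s(v, u), fun _ => ⟨h, Or.inl ⟨u, rfl, ?_⟩⟩⟩
        have e := SimpleGraph.ConnectedComponent.sound h.symm.reachable
        change H.dist (root (H.connectedComponentMk u)) u + 1 =
          H.dist (root (H.connectedComponentMk v)) v
        rw [e, hρ, H.dist_comm, H.dist_comm (u := ρ) (v := v)]
        obtain ⟨q', hq'⟩ := q.reachable.exists_walk_length_eq_dist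
        have h₁ := SimpleGraph.dist_le q
        have h₂ := SimpleGraph.dist_le (SimpleGraph.Walk.cons h q')
        rw [SimpleGraph.Walk.length_cons] at hp h₂
        lia
  choose f hf using key
  refine ⟨f, fun v hv v' hv' e => ?_, fun v hv => (hf v hv).1⟩
  rcases (hf v hv).2 with ⟨u, h₁, h₂⟩ | ⟨h₁, x, y, h₂, h₃, h₄, h₅, h₆⟩ <;>
    rcases (hf v' hv').2 with ⟨u', h₁', h₂'⟩ | ⟨h₁', x', y', h₂', h₃', h₄', h₅', h₆'⟩
  · rw [h₁, h₁', Sym2.eq_iff] at e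
    rcases e with e | ⟨rfl, rfl⟩
    · exact e.1
    · lia
  · rw [h₁, h₂', Sym2.eq_iff] at e
    rcases e with ⟨rfl, rfl⟩ | ⟨rfl, rfl⟩ <;> lia
  · rw [h₂, h₁', Sym2.eq_iff] at e
    rcases e with ⟨rfl, rfl⟩ | ⟨rfl, rfl⟩ <;> lia
  · rw [h₂, h₂', Sym2.eq_iff] at e
    have hc : H.connectedComponentMk v = H.connectedComponentMk v' := by
      rcases e with ⟨rfl, rfl⟩ | ⟨rfl, rfl⟩
      · rw [← h₅, h₅']
      · rw [← h₅, h₆']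
    rw [h₁, h₁', hc]

/-- A completion set can be replaced by a cover with pairs at distance two. -/
theorem IsCompletionSet.exists_isDistTwoCover [Fintype V]
    (hG : ∀ c : G.ConnectedComponent, 3 ≤ c.supp.ncard) {F : Finset (Sym2 V)}
    (hF : IsCompletionSet G F) :
    ∃ F' : Finset (Sym2 V), IsDistTwoCover G F' ∧ F'.card ≤ F.card := by
  classical
  have hne : ∀ {u v}, s(u, v) ∈ F → u ≠ v := fun h => by simpa using (hF.1 _ h).1
  have hnadj : ∀ {u v}, s(u, v) ∈ F → ¬ G.Adj u v := fun h => by simpa using (hF.1 _ h).2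
  let H : SimpleGraph V :=
    { Adj := fun u v => s(u, v) ∈ F ∧ G.dist u v ≠ 2
      symm := ⟨fun u v h => by rwa [Sym2.eq_swap, G.dist_comm]⟩
      loopless := ⟨fun u h => hne h.1 rfl⟩ }
  let W : Set V := {w | w ∈ unsaturated G ∧
    ∀ u v, s(u, v) ∈ F → G.dist u v = 2 → w ∉ coverSet G u v}
  have hWH : ∀ {w x}, w ∈ W → s(w, x) ∈ F → H.Adj w x := fun {w x} hw h =>
    ⟨h, fun e => hw.2 w x h e (left_mem_coverSet hw.1 x)⟩
  have hadj : ∀ {u v}, (G ⊔ SimpleGraph.fromEdgeSet (F : Set (Sym2 V))).Adj u v ↔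
      G.Adj u v ∨ s(u, v) ∈ F := by
    intro u v
    simp only [SimpleGraph.sup_adj, SimpleGraph.fromEdgeSet_adj, Finset.mem_coe]
    exact or_congr_right ⟨fun h => h.1, fun h => ⟨h, hne h⟩⟩
  -- The triangle at `w` in `G + F` has an edge of `F` at `w`, since otherwise its third edge would
  -- be a distance-two pair covering `w`. That edge lies in `H`, because a distance-two pair covers
  -- its unsaturated ends.
  have hW : ∀ w ∈ W, ∃ x y, H.Adj w x ∧ ((G.Adj w y ∧ s(x, y) ∈ F) ∨
      (H.Adj w y ∧ (G.Adj x y ∨ s(x, y) ∈ F))) := by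
    intro w hw
    obtain ⟨x, y, hx, hy, hxy⟩ := hF.2 w
    rw [hadj] at hx hy hxy
    rcases hx with hx | hx <;> rcases hy with hy | hy
    · rcases hxy with hxy | hxy
      · exact absurd ⟨x, y, hx, hy, hxy⟩ hw.1
      · exact absurd (Or.inl ⟨hw.1, hx.symm, hy.symm⟩) (hw.2 x y hxy
          (dist_eq_two_iff.2 ⟨hne hxy, hnadj hxy, w, hx.symm, hy.symm⟩))
    · rcases hxy with hxy | hxy
      · exact absurd (dist_eq_two_iff.2 ⟨hne hy, hnadj hy, x, hx, hxy.symm⟩) (hWH hw hy).2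
      · exact ⟨y, x, hWH hw hy, Or.inl ⟨hx, by rwa [Sym2.eq_swap]⟩⟩
    · rcases hxy with hxy | hxy
      · exact absurd (dist_eq_two_iff.2 ⟨hne hx, hnadj hx, y, hy, hxy⟩) (hWH hw hx).2
      · exact ⟨x, y, hWH hw hx, Or.inl ⟨hy, hxy⟩⟩
    · exact ⟨x, y, hWH hw hx, Or.inr ⟨hWH hw hy, hxy⟩⟩
  -- If the component `C` lies inside `W` and contains no edge of `G`, the triangle provided by `hW`
  -- must lie entirely in `H`.
  have hroot : ∀ C : H.ConnectedComponent, ∃ r, H.connectedComponentMk r = C ∧ (r ∉ W ∨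
      InTriangle H r ∨ ∃ y, y ≠ r ∧ y ∈ W ∧ H.connectedComponentMk y = C ∧
        ∃ u v, G.dist u v = 2 ∧ r ∈ coverSet G u v ∧ y ∈ coverSet G u v) := by
    intro C
    by_cases h₁ : ∃ v, H.connectedComponentMk v = C ∧ v ∉ W
    · obtain ⟨v, hv, hv'⟩ := h₁
      exact ⟨v, hv, Or.inl hv'⟩
    push Not at h₁
    by_cases h₂ : ∃ w y, H.connectedComponentMk w = C ∧ H.connectedComponentMk y = C ∧ G.Adj w y
    · obtain ⟨w, y, hw, hy, h⟩ := h₂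
      exact ⟨w, hw, Or.inr (Or.inr ⟨y, h.ne', h₁ y hy, hy,
        exists_coverSet_pair hG (h₁ w hw).1 (h₁ y hy).1 h⟩)⟩
    push Not at h₂
    obtain ⟨w, hw⟩ := C.exists_rep
    replace hw : H.connectedComponentMk w = C := hw
    have hmk : ∀ {a b}, H.connectedComponentMk a = C → H.Adj a b → H.connectedComponentMk b = C :=
      fun ha hab => (SimpleGraph.ConnectedComponent.sound hab.symm.reachable).trans ha
    refine ⟨w, hw, Or.inr (Or.inl ?_)⟩
    obtain ⟨x, y, hx, ⟨hy, hxy⟩ | ⟨hy, hxy | hxy⟩⟩ := hW w (h₁ w hw)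
    · exact absurd hy (h₂ w y hw (hmk (hmk hw hx) (hWH (h₁ x (hmk hw hx)) hxy)))
    · exact absurd hxy (h₂ x y (hmk hw hx) (hmk hw hy))
    · exact ⟨x, y, hx, hy, hWH (h₁ x (hmk hw hx)) hxy⟩
  choose root hr₁ hr₂ using hroot
  obtain ⟨f, hinj, hf⟩ := exists_injOn_edgeSet H root hr₁
  have hq : ∀ v, ∃ e : Sym2 V, v ∈ W → (∀ a b, e = s(a, b) → G.dist a b = 2) ∧
      (∃ a b, e = s(a, b) ∧ v ∈ coverSet G a b) := by
    intro v
    by_cases hv : v ∈ W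
    · obtain ⟨a, b, h₁, h₂⟩ := exists_mem_coverSet hG hv.1
      refine ⟨s(a, b), fun _ => ⟨fun a' b' e => ?_, a, b, rfl, h₂⟩⟩
      rw [Sym2.eq_iff] at e
      rcases e with ⟨rfl, rfl⟩ | ⟨rfl, rfl⟩
      · exact h₁
      · rwa [G.dist_comm]
    · exact ⟨s(v, v), fun h => absurd h hv⟩
  -- The vertices of `W` that own an edge of `H` under `f`.
  let T : Finset V := {v | v ∈ W ∧ (v ≠ root (H.connectedComponentMk v) ∨ InTriangle H v)}
  have hcov : ∃ q : V → Sym2 V, (∀ v ∈ T, ∀ a b, q v = s(a, b) → G.dist a b = 2) ∧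
      ∀ w ∈ W, ∃ v ∈ T, ∃ a b, q v = s(a, b) ∧ w ∈ coverSet G a b := by
    choose q₀ hq₀ using hq
    -- Each vertex of `T` prefers a pair that also covers its root, so a root in `W` without an edge
    -- of its own is covered by its partner's pair.
    have hq : ∀ v, ∃ e : Sym2 V, v ∈ T → (∀ a b, e = s(a, b) → G.dist a b = 2) ∧
        (∃ a b, e = s(a, b) ∧ v ∈ coverSet G a b) ∧
        ((∃ a b, G.dist a b = 2 ∧ v ∈ coverSet G a b ∧
          root (H.connectedComponentMk v) ∈ coverSet G a b) →
          ∃ a b, e = s(a, b) ∧ root (H.connectedComponentMk v) ∈ coverSet G a b) := by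
      intro v
      by_cases h : ∃ a b, G.dist a b = 2 ∧ v ∈ coverSet G a b ∧
          root (H.connectedComponentMk v) ∈ coverSet G a b
      · obtain ⟨a, b, h₁, h₂, h₃⟩ := h
        refine ⟨s(a, b), fun _ => ⟨fun a' b' e => ?_, ⟨a, b, rfl, h₂⟩, fun _ => ⟨a, b, rfl, h₃⟩⟩⟩
        rw [Sym2.eq_iff] at e
        rcases e with ⟨rfl, rfl⟩ | ⟨rfl, rfl⟩
        · exact h₁
        · rwa [G.dist_comm]
      · refine ⟨q₀ v, fun hv => ?_⟩
        have hv' : v ∈ W := (Finset.mem_filter.1 hv).2.1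
        exact ⟨(hq₀ v hv').1, (hq₀ v hv').2, fun h' => absurd h' h⟩
    choose q hq using hq
    refine ⟨q, fun v hv => (hq v hv).1, fun w hw => ?_⟩
    by_cases hwT : w ∈ T
    · exact ⟨w, hwT, (hq w hwT).2.1⟩
    · have hwT' : w = root (H.connectedComponentMk w) ∧ ¬ InTriangle H w := by
        by_contra hcon
        exact hwT (Finset.mem_filter.2 ⟨Finset.mem_univ _, hw, by tauto⟩)
      have h₂ := hr₂ (H.connectedComponentMk w)
      rw [← hwT'.1] at h₂
      obtain ⟨y, hy₁, hy₂, hy₃, u, v, huv, hu, hv⟩ :=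
        (h₂.resolve_left (not_not.2 hw)).resolve_left hwT'.2
      have hyT : y ∈ T := by
        refine Finset.mem_filter.2 ⟨Finset.mem_univ _, hy₂, Or.inl ?_⟩
        rw [hy₃, ← hwT'.1]
        exact hy₁
      have h₃ := (hq y hyT).2.2
      rw [hy₃, ← hwT'.1] at h₃
      exact ⟨y, hyT, h₃ ⟨u, v, huv, hv, hu⟩⟩
  obtain ⟨q, hq₁, hq₂⟩ := hcov
  have hsub : T.image f ⊆ F.filter fun e => e ∈ H.edgeSet := by
    intro e he
    obtain ⟨v, hv, rfl⟩ := Finset.mem_image.1 he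
    have hv' := hf v (Finset.mem_filter.1 hv).2.2
    refine Finset.mem_filter.2 ⟨?_, hv'⟩
    generalize f v = e at hv'
    induction e with
    | _ a b => exact hv'.1
  have hTcard : T.card ≤ (F.filter fun e => e ∈ H.edgeSet).card := by
    rw [← Finset.card_image_of_injOn (f := f) (s := T)
      (hinj.mono fun v hv => (Finset.mem_filter.1 hv).2.2)]
    exact Finset.card_le_card hsub
  -- The distance-two pairs of `F` are kept; the edges of `H` give way to one pair per vertex of
  -- `T`.
  refine ⟨(F.filter fun e => ¬ e ∈ H.edgeSet) ∪ T.image q, ⟨fun u v h => ?_, fun w hw => ?_⟩, ?_⟩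
  · rcases Finset.mem_union.1 h with h | h
    · rw [Finset.mem_filter] at h
      by_contra hd
      exact h.2 ⟨h.1, hd⟩
    · obtain ⟨x, hx, e⟩ := Finset.mem_image.1 h
      exact hq₁ x hx u v e
  · by_cases hwW : w ∈ W
    · obtain ⟨v, hv, a, b, e, h⟩ := hq₂ w hwW
      exact ⟨a, b, Finset.mem_union_right _ (Finset.mem_image.2 ⟨v, hv, e⟩), h⟩
    · have : ∃ u v, s(u, v) ∈ F ∧ G.dist u v = 2 ∧ w ∈ coverSet G u v := by
        by_contra! hcon
        exact hwW ⟨hw, hcon⟩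
      obtain ⟨u, v, h₁, h₂, h₃⟩ := this
      exact ⟨u, v, Finset.mem_union_left _ (Finset.mem_filter.2 ⟨h₁, fun h => h.2 h₂⟩), h₃⟩
  · have h₁ := Finset.card_union_le (F.filter fun e => ¬ e ∈ H.edgeSet) (T.image q)
    have h₂ : (T.image q).card ≤ T.card := Finset.card_image_le
    have h₃ := Finset.card_filter_add_card_filter_not (s := F) fun e => e ∈ H.edgeSet
    lia

theorem exists_isDistTwoCover_card_eq [Fintype V]
    (hG : ∀ c : G.ConnectedComponent, 3 ≤ c.supp.ncard) :
    ∃ F : Finset (Sym2 V), IsDistTwoCover G F ∧ F.card = completionNumber G := by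
  classical
  have hex : {k | ∃ F : Finset (Sym2 V), IsCompletionSet G F ∧ F.card = k}.Nonempty := by
    -- All pairs at distance two form a cover, so the infimum is attained.
    refine ⟨_, Finset.univ.filter fun e => ∀ u v, e = s(u, v) → G.dist u v = 2,
      IsDistTwoCover.isCompletionSet ⟨fun u v h => ?_, fun w hw => ?_⟩, rfl⟩
    · exact (Finset.mem_filter.1 h).2 u v rfl
    · obtain ⟨u, v, h₁, h₂⟩ := exists_mem_coverSet hG hw
      refine ⟨u, v, Finset.mem_filter.2 ⟨Finset.mem_univ _, fun a b e => ?_⟩, h₂⟩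
      rw [Sym2.eq_iff] at e
      rcases e with ⟨rfl, rfl⟩ | ⟨rfl, rfl⟩
      · exact h₁
      · rwa [G.dist_comm]
  obtain ⟨F, hF, hk⟩ := Nat.sInf_mem hex
  obtain ⟨F', h₁, h₂⟩ := hF.exists_isDistTwoCover hG
  refine ⟨F', h₁, le_antisymm (h₂.trans hk.le) (Nat.sInf_le ⟨F', h₁.isCompletionSet, rfl⟩)⟩

end Cover

/-! ### The harmonic bound for greedy Set Cover -/

section Greedy

variable {V : Type*} {G : SimpleGraph V}

theorem GreedyRun.dist_eq_two {R : Set V} {L : List (V × V)} (h : GreedyRun G R L) :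
    ∀ p ∈ L, G.dist p.1 p.2 = 2 := by
  induction h with
  | done => simp
  | step hd _ _ _ ih =>
    intro p hp
    rcases List.mem_cons.1 hp with rfl | hp
    · exact hd
    · exact ih p hp

theorem GreedyRun.exists_mem {R : Set V} {L : List (V × V)} (h : GreedyRun G R L) :
    ∀ w ∈ R, ∃ p ∈ L, w ∈ coverSet G p.1 p.2 := by
  induction h with
  | done => simp
  | @step R u v L _ _ _ _ ih =>
    intro w hw
    by_cases hc : w ∈ coverSet G u v
    · exact ⟨(u, v), List.mem_cons_self, hc⟩
    · obtain ⟨p, hp, h⟩ := ih w ⟨hw, hc⟩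
      exact ⟨p, List.mem_cons_of_mem _ hp, h⟩

theorem GreedyRun.isDistTwoCover [DecidableEq V] {L : List (V × V)}
    (h : GreedyRun G (unsaturated G) L) :
    IsDistTwoCover G (L.map fun p => s(p.1, p.2)).toFinset := by
  refine ⟨fun u v huv => ?_, fun w hw => ?_⟩
  · obtain ⟨p, hp, e⟩ := List.mem_map.1 (List.mem_toFinset.1 huv)
    have := h.dist_eq_two p hp
    rw [Sym2.eq_iff] at e
    rcases e with ⟨e₁, e₂⟩ | ⟨e₁, e₂⟩
    · rwa [← e₁, ← e₂]
    · rwa [← e₁, ← e₂, G.dist_comm]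
  · obtain ⟨p, hp, h⟩ := h.exists_mem w hw
    exact ⟨p.1, p.2, List.mem_toFinset.2 (List.mem_map.2 ⟨p, hp, rfl⟩), h⟩

/-- Each of the last `c` terms of `harmonic r` is at least `1 / r`. -/
theorem harmonic_sub_add_div_le {r : ℕ} (hr : 0 < r) (c : ℕ) (hc : c ≤ r) :
    harmonic (r - c) + (c : ℚ) / r ≤ harmonic r := by
  induction c with
  | zero => simp
  | succ c ih =>
    have h := ih (by lia)
    obtain ⟨k, hk⟩ : ∃ k, r - c = k + 1 := ⟨r - c - 1, by lia⟩
    have hk' : r - (c + 1) = k := by lia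
    rw [hk, harmonic_succ] at h
    rw [hk']
    have hinv : ((r : ℚ))⁻¹ ≤ ((k + 1 : ℕ) : ℚ)⁻¹ := by
      apply inv_anti₀ (by positivity)
      exact_mod_cast (by lia : k + 1 ≤ r)
    have : ((c + 1 : ℕ) : ℚ) / r = c / r + (r : ℚ)⁻¹ := by
      push_cast
      ring
    rw [this]
    linarith

/-- If a step covers `c` of `r` vertices, maximality of `c` and the cover `F` give `r ≤ F.card * c`.
So the step costs `1 ≤ F.card * (c / r)`, which the drop from `harmonic r` to `harmonic (r - c)`
pays for. -/
theorem GreedyRun.length_le [Fintype V] {R : Set V} {L : List (V × V)} (h : GreedyRun G R L)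
    {F : Finset (Sym2 V)} (hF : IsDistTwoCover G F) (hR : R ⊆ unsaturated G) :
    (L.length : ℚ) ≤ F.card * harmonic R.ncard := by
  classical
  induction h with
  | done => simp
  | @step R u v L hd hpos hmax _ ih =>
    have ih := ih (Set.sdiff_subset.trans hR)
    set c := (R ∩ coverSet G u v).ncard with hc
    have hle : R.ncard ≤ F.card * c := by
      rw [Set.ncard_eq_toFinset_card' R]
      refine le_trans (Finset.card_le_card (t := F.biUnion fun e =>
        ({w | w ∈ R ∧ ∃ a b, e = s(a, b) ∧ w ∈ coverSet G a b} : Finset V)) fun w hw => ?_)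
        (Finset.card_biUnion_le_card_mul _ _ _ fun e he => ?_)
      · rw [Set.mem_toFinset] at hw
        obtain ⟨a, b, h₁, h₂⟩ := hF.2 w (hR hw)
        simp only [Finset.mem_biUnion, Finset.mem_filter, Finset.mem_univ, true_and]
        exact ⟨s(a, b), h₁, hw, a, b, rfl, h₂⟩
      · induction e with
        | _ a b =>
          refine le_trans (le_of_eq ?_) (hmax a b (hF.1 a b he))
          rw [← Set.ncard_coe_finset]
          congr 1
          ext w
          simp only [Finset.coe_filter, Finset.mem_univ, true_and, Set.mem_ofPred_eq,
            Set.mem_inter_iff]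
          refine and_congr_right fun _ => ⟨fun ⟨a', b', e, h⟩ => ?_, fun h => ⟨a, b, rfl, h⟩⟩
          rw [Sym2.eq_iff] at e
          rcases e with ⟨rfl, rfl⟩ | ⟨rfl, rfl⟩
          · exact h
          · rwa [coverSet_comm]
    have hcR : c ≤ R.ncard := Set.ncard_le_ncard Set.inter_subset_left
    have hc₀ : 0 < c := (Set.ncard_pos).2 hpos
    have hdiff : (R \ coverSet G u v).ncard = R.ncard - c := by
      have := Set.ncard_inter_add_ncard_sdiff_eq_ncard R (coverSet G u v)
      lia
    rw [hdiff] at ih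
    have hr : 0 < R.ncard := hc₀.trans_le hcR
    have hh := harmonic_sub_add_div_le hr c hcR
    have hle' : (1 : ℚ) ≤ F.card * ((c : ℚ) / R.ncard) := by
      rw [← mul_div_assoc, one_le_div (by exact_mod_cast hr)]
      exact_mod_cast hle
    have := mul_le_mul_of_nonneg_left hh (Nat.cast_nonneg (α := ℚ) F.card)
    rw [List.length_cons]
    push_cast
    linarith

end Greedy

/-! ### The algorithm and the final estimate -/

/-- The sets of pairs chosen by the greedy algorithm are computed in polynomial time. -/
theorem exists_greedy_isPolyTime : ∃ A : ∀ n : ℕ, SimpleGraph (Fin n) → Finset (Sym2 (Fin n)),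
    IsPolyTime A ∧ ∀ (n : ℕ) (G : SimpleGraph (Fin n)),
      ∃ (L : List (Fin n × Fin n)) (R : Set (Fin n)),
        A n G = (L.map fun p => s(p.1, p.2)).toFinset ∧
        (∀ L', GreedyRun G R L' → GreedyRun G (unsaturated G) (L ++ L')) ∧
        R ⊆ unsaturated G ∧ CoversAtMost G 0 R := by
  have key : ∀ (n : ℕ) (G : SimpleGraph (Fin n)), ∃ S : Finset (Sym2 (Fin n)),
      (∃ a : ℕ → Bool, (∀ i j : Fin n, a (i * n + j) = true ↔ G.Adj i j) ∧
        (greedyCmd n 0 (Mem.init a)).out = encodePairSet ⟨n, S⟩) ∧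
      ∃ (L : List (Fin n × Fin n)) (R : Set (Fin n)),
        S = (L.map fun p => s(p.1, p.2)).toFinset ∧
        (∀ L', GreedyRun G R L' → GreedyRun G (unsaturated G) (L ++ L')) ∧
        R ⊆ unsaturated G ∧ CoversAtMost G 0 R := fun n G =>
    let ⟨a, L, R, ha, hout, h⟩ := exists_greedyCmd n G
    ⟨_, ⟨a, ha, hout⟩, L, R, rfl, h⟩
  choose A h₁ h₂ using key
  exact ⟨A, isCmd_greedyCmd.isPolyTime h₁, h₂⟩

end DeltaCompletion

theorem mainTheorem5 :
    ∃ A : ∀ n : ℕ, SimpleGraph (Fin n) → Finset (Sym2 (Fin n)),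
      DeltaCompletion.IsPolyTime A ∧
      ∀ (n : ℕ) (G : SimpleGraph (Fin n)),
        (∀ c : G.ConnectedComponent, 3 ≤ c.supp.ncard) →
          (DeltaCompletion.IsCompletionSet G (A n G) ∧
            ((A n G).card : ℝ) ≤
              (Real.log (n : ℝ) + 1) * (DeltaCompletion.completionNumber G : ℝ)) ∧
          (∃ L : List (Fin n × Fin n),
            DeltaCompletion.GreedyRun G (DeltaCompletion.unsaturated G) L ∧
              A n G = (L.map fun p => s(p.1, p.2)).toFinset) ∧
          (∃ F : Finset (Sym2 (Fin n)),
            DeltaCompletion.IsCompletionSet G F ∧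
              F.card = DeltaCompletion.completionNumber G ∧
              ∀ u v, s(u, v) ∈ F → G.dist u v = 2) := by
  obtain ⟨A, hA, hspec⟩ := DeltaCompletion.exists_greedy_isPolyTime
  refine ⟨A, hA, fun n G hG => ?_⟩
  obtain ⟨L, R, hAL, hL, hRU, hc⟩ := hspec n G
  rw [hAL]
  -- With components of order at least three every unsaturated vertex lies in some set, so nothing
  -- is left over and the run is complete.
  have hR : R = ∅ := by
    by_contra hne
    obtain ⟨w, hw⟩ := Set.nonempty_iff_ne_empty.2 hne
    obtain ⟨u, v, h₁, h₂⟩ := DeltaCompletion.exists_mem_coverSet hG (hRU hw)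
    have h₃ : 0 < (R ∩ DeltaCompletion.coverSet G u v).ncard :=
      (Set.ncard_pos).2 ⟨w, hw, h₂⟩
    exact (hc u v h₁).not_gt h₃
  have hrun : DeltaCompletion.GreedyRun G (DeltaCompletion.unsaturated G) (L) := by
    have := hL []
    rw [hR, List.append_nil] at this
    exact this DeltaCompletion.GreedyRun.done
  obtain ⟨F, hF, hcard⟩ := DeltaCompletion.exists_isDistTwoCover_card_eq hG
  refine ⟨⟨hrun.isDistTwoCover.isCompletionSet, ?_⟩, ⟨L, hrun, rfl⟩,
    F, hF.isCompletionSet, hcard, hF.1⟩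
  have h₁ : (((L).map fun p => s(p.1, p.2)).toFinset.card : ℝ) ≤ (L).length := by
    refine Nat.cast_le.2 ((List.toFinset_card_le _).trans_eq ?_)
    rw [List.length_map]
  have h₂ := hrun.length_le hF subset_rfl
  rw [hcard] at h₂
  have h₃ : ((L).length : ℝ) ≤ DeltaCompletion.completionNumber G *
      (harmonic (DeltaCompletion.unsaturated G).ncard : ℝ) := by
    exact_mod_cast h₂
  have h₄ : (harmonic (DeltaCompletion.unsaturated G).ncard : ℝ) ≤ Real.log n + 1 := by
    have hU : (DeltaCompletion.unsaturated G).ncard ≤ n := by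
      simpa using Set.ncard_le_card (DeltaCompletion.unsaturated G)
    refine (harmonic_le_one_add_log _).trans ?_
    rw [add_comm]
    gcongr ?_ + 1
    -- Without unsaturated vertices the convention `Real.log 0 = 0` is used; the bound then needs
    -- only `0 ≤ Real.log n`, which holds for `n = 0` too.
    rcases Nat.eq_zero_or_pos (DeltaCompletion.unsaturated G).ncard with h | h
    · rw [h, Nat.cast_zero, Real.log_zero]
      exact Real.log_natCast_nonneg n
    · exact Real.log_le_log (by exact_mod_cast h) (by exact_mod_cast hU)
  calc _ ≤ _ := h₁
    _ ≤ _ := h₃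
    _ ≤ _ := mul_le_mul_of_nonneg_left h₄ (Nat.cast_nonneg _)
    _ = _ := mul_comm _ _
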